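/- Let $k$ be an algebraically closed field, $r\ge 0$ an integer, and $k[\mathbf x]=k[x_1,\dots,x_r]$. Let $\beta$ be a *basis set* of $n$ monomials, i.e. a finite nonempty set of monomials in $x_1,\dots,x_r$ that contains every divisor of each of its members, with $|\beta|=n$; let $I_\beta\subseteq k[\mathbf x]$ be the ideal generated by the monomials not in $\beta$. **The chart $U_\beta$.** Let $U_\beta=\operatorname{Spec}R$ be the affine open chart of $\operatorname{Hilb}^n(\mathbb A^r_k)$ that represents the functor sending a $k$-algebra $A$ to the set of ideals $J\subseteq A[\mathbf x]$ such that $A[\mathbf x]/J$ is a free $A$-module with basis $\beta$. For $\mathbf x^{\mathbf d}\notin\beta$, $\mathbf x^{\mathbf j}\in\beta$ let $c^{\mathbf d}_{\mathbf j}\in R$ be the coefficient of $\mathbf x^{\mathbf j}$ when $\mathbf x^{\mathbf d}$ is expanded in the basis $\beta$ modulo the universal ideal of $R[\mathbf x]$. Explicitly, $R=k[C^{\mathbf d}_{\mathbf j}:\mathbf d\notin\beta,\mathbf j\in\beta]/(\tau)$ with $c^{\mathbf d}_{\mathbf j}$ the class of $C^{\mathbf d}_{\mathbf j}$, where the relations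 are $\tau=C^{\mathbf d+\mathbf e_i}_{\mathbf j_0}-\sum_{\mathbf j\in\beta}C^{\mathbf d}_{\mathbf j}C^{\mathbf j+\mathbf e_i}_{\mathbf j_0}$ for $\mathbf d\notin\beta$, $\mathbf j_0\in\beta$, $1\le i\le r$ (with $C^{\mathbf b}_{\mathbf j}=\delta_{\mathbf b\mathbf j}$ for $\mathbf b\in\beta$), and the universal ideal is generated by the polynomials $\mathbf x^{\mathbf d}-\sum_{\mathbf j\in\beta}c^{\mathbf d}_{\mathbf j}\mathbf x^{\mathbf j}$. Let $t_\beta\in U_\beta$ be the point corresponding to $I_\beta$, i.e. the point where all $c^{\mathbf d}_{\mathbf j}$ with $\mathbf d\notin\beta$ vanish, and $M\subseteq R$ its maximal ideal, so that $M/M^2$ is the cotangent space at $t_\beta$. **Arrows.** The pair $(\mathbf d,\mathbf j)$ with $\mathbf d\notin\beta$, $\mathbf j\in\beta$ (equivalently $c^{\mathbf d}_{\mathbf j}$) is an *arrow* with *tail* $\mathbf x^{\mathbf d}$ and *head* $\mathbf x^{\mathbf j}$. It is *minimal* if $\mathbf x^{\mathbf d}$ is a minimal generator of $I_\beta$, and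 ($x_i$-)*standard* if $\mathbf j-\mathbf d$ has exactly one negative component (the $i$-th); its *$x_i$-offset* is $\mathbf j-\mathbf d$ with the $i$-th component deleted, its *$x_i$-height* is $d_i$, and its *$x_i$-shadow* is the set of arrows $(\mathbf d,\mathbf j-s\mathbf e_i)$, $0\le s\le j_i$. Two arrows are *translation-equivalent*, written $\sim$, if one can be moved to the other by unit steps $\pm\mathbf e_k$ applied simultaneously to tail and head, with all intermediate positions being arrows. An arrow is $\sim 0$ if it is $\sim(\mathbf d',\mathbf j')$ with, for some $k$, $j'_k=0$, $d'_k>0$ and $\mathbf d'-\mathbf e_k\notin\beta$. An $x_i$-standard arrow *can be advanced* if it is $\sim0$ or is $\sim$ an arrow of strictly smaller $x_i$-height. **Iterated shadow promotion.** Let $(\mathbf d,\mathbf j)$ be an $x_i$-standard arrow that can be advanced. On a translation path that advances it let $(\mathbf d_1,\mathbf j_1)$ be the first position with $(\mathbf d_1)_i=d_i$ and $\mathbf d_1-\mathbf e_i\in\mathbb N^r\setminus\beta$; choose a minimal generator $\mathbf x^{\mathbf b}$ of $I_\beta$ dividing $\mathbf x^{\mathbf d_1-\mathbf e_i}$, and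 let $\mathbf j_2$ have $i$-th component $(\mathbf j_1)_i$ and $k$-th component $(\mathbf j_1)_k-(\mathbf d_1)_k+b_k$ for $k\ne i$. The $x_i$-shadow of $(\mathbf b,\mathbf j_2)$ is called a *promotion image* of the $x_i$-shadow of $(\mathbf d,\mathbf j)$. For each $i$ let $x_i^{w_i}$ be the least power of $x_i$ not in $\beta$. For each $i$ and each offset $v$, start with the set of all arrows with tail $x_i^{w_i}$ and $x_i$-offset $v$; as long as some arrow of the current set can be advanced, take the one among these whose head has maximal $x_i$-degree and replace its $x_i$-shadow by a promotion image; stop when no arrow of the set can be advanced. A *standard bunch* is a union, over all $i$ and $v$, of final sets obtained in this way, for some choices of paths and generators. **Theorem.** (0) The explicitly presented ring $R$ with its universal ideal represents the functor above, and $t_\beta$ corresponds to $I_\beta$. (1) A standard bunch exists. (2) Every standard bunch $\mathcal S$ is a set of exactly $rn$ minimal standard arrows, whose images in $M/M^2$ are $k$-linearly independent. (3) Consequently $\dim_k M/M^2\ge rn$, and for every standard bunch $\mathcal S$ the point $t_\beta$ is nonsingular (its local ring $R_M=\mathcal O_{\operatorname{Hilb}^n(\mathbb A^r_k),t_\beta}$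 is regular) if and only if $\mathcal S$ spans $M/M^2$. -/

import Mathlib

open MvPolynomial

universe u

/-- A basis set: a finite nonempty set of monomials in `x_1, …, x_r` (given by their exponent
vectors) that is closed under taking divisors. -/
structure BasisSet (r : ℕ) where
  monos : Finset (Fin r →₀ ℕ)
  nonempty : monos.Nonempty
  mem_of_le : ∀ {j m : Fin r →₀ ℕ}, j ∈ monos → m ≤ j → m ∈ monos

/-- An arrow `c^d_j` for `β`: the tail `x^d` lies outside `β`, the head `x^j` lies in `β`. -/
@[ext]
structure Arrow {r : ℕ} (β : BasisSet r) where
  tail : Fin r →₀ ℕ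
  head : Fin r →₀ ℕ
  tail_notMem : tail ∉ β.monos
  head_mem : head ∈ β.monos

namespace Arrow

variable {r : ℕ} {β : BasisSet r}

/-- One discrete step in a variable direction, upwards or downwards; source and target both being
arrows, the head stays inside `β` and the tail outside `β`. -/
def Step (a b : Arrow β) : Prop :=
  ∃ i : Fin r,
    (b.tail = a.tail + Finsupp.single i 1 ∧ b.head = a.head + Finsupp.single i 1) ∨
    (a.tail = b.tail + Finsupp.single i 1 ∧ a.head = b.head + Finsupp.single i 1)

/-- Translation-equivalence `a ∼ b`. -/
def TransEquiv (a b : Arrow β) : Prop := Relation.ReflTransGen Step a b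

/-- `x^{tail}/x_i` is a monomial outside `β`. -/
def TailCanDrop (i : Fin r) (a : Arrow β) : Prop :=
  ∃ m : Fin r →₀ ℕ, m ∉ β.monos ∧ a.tail = m + Finsupp.single i 1

/-- `a ∼ 0`: the arrow can be translated to a position from which one more degree-decreasing step
moves the head out of the first orthant, the tail remaining a monomial outside `β`. -/
def EquivZero (a : Arrow β) : Prop :=
  ∃ b : Arrow β, TransEquiv a b ∧ ∃ i : Fin r, b.head i = 0 ∧ TailCanDrop i b

/-- `a` is standard for `x_i`: the `i`-th component of the vector `head - tail` is its only
negative component. -/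
def IsStandardFor (i : Fin r) (a : Arrow β) : Prop :=
  a.head i < a.tail i ∧ ∀ k, k ≠ i → a.tail k ≤ a.head k

/-- `a` is standard: the vector of `a` has exactly one negative component. -/
def IsStandard (a : Arrow β) : Prop := ∃ i, IsStandardFor i a

/-- `a` is minimal: its tail is a minimal generator of `I_β`, that is, a minimal monomial outside
`β` for the divisibility order. -/
def IsMinimal (a : Arrow β) : Prop := Minimal (fun d => d ∉ β.monos) a.tail

/-- The `x_i`-offset: the vector `head - tail` with the `i`-th component deleted. -/
def offset (i : Fin r) (a : Arrow β) : {k : Fin r // k ≠ i} → ℤ :=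
  fun k => (a.head k : ℤ) - (a.tail k : ℤ)

/-- The `x_i`-shadow of `a`: the arrows with the same tail whose head is `x^{head}/x_i^s` for some
`0 ≤ s ≤ deg_{x_i} x^{head}`. -/
def shadow (i : Fin r) (a : Arrow β) : Set (Arrow β) :=
  {b | b.tail = a.tail ∧ ∃ s : ℕ, a.head = b.head + Finsupp.single i s}

/-- `a` can be advanced (in the `x_i`-direction): `a ∼ 0`, or `a ∼ b` with `b` of strictly smaller
`x_i`-height, the `x_i`-height being the `x_i`-degree of the tail. -/
def CanAdvance (i : Fin r) (a : Arrow β) : Prop :=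
  EquivZero a ∨ ∃ b : Arrow β, TransEquiv a b ∧ b.tail i < a.tail i

/-- A position of `a` at the same `x_i`-height as `a` from which the tail can make one step in the
decreasing `x_i`-direction while staying outside `β`. -/
def IsExit (i : Fin r) (a p : Arrow β) : Prop := p.tail i = a.tail i ∧ TailCanDrop i p

/-- `p` is the first exit position on some translation path starting at `a`. (For an `x_i`-standard
arrow `a` such a path extends by one step to one that advances `a`, and every path that
advances `a` has a first exit position.) -/
def IsFirstExit (i : Fin r) (a p : Arrow β) : Prop :=
  Relation.ReflTransGen (fun q q' => Step q q' ∧ ¬ IsExit i a q) a p ∧ IsExit i a p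

/-- The `x_i`-shadow of `c` is a promotion image of the `x_i`-shadow of `a`. With `p = c^{d₁}_{j₁}`
the first exit position on a path advancing `a`, the tail of `c` is a minimal generator of `I_β`
dividing `x^{d₁}/x_i`, and the head of `c` is obtained from `x^{j₁}` by dividing out, in the
variables other than `x_i`, the quotient of `x^{d₁}` by the tail of `c`. -/
def Promotes (i : Fin r) (a c : Arrow β) : Prop :=
  ∃ p : Arrow β, IsFirstExit i a p ∧
    IsMinimal c ∧ c.tail + Finsupp.single i 1 ≤ p.tail ∧
    c.head i = p.head i ∧ ∀ k, k ≠ i → c.head k + p.tail k = p.head k + c.tail k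

/-- One round of shadow promotion: among the arrows of `T` that can be advanced choose the one, `a`,
whose head has maximal `x_i`-degree, and replace its `x_i`-shadow by a promotion image. -/
def PromotionRound (i : Fin r) (T T' : Set (Arrow β)) : Prop :=
  ∃ a ∈ T, CanAdvance i a ∧ (∀ b ∈ T, CanAdvance i b → b.head i ≤ a.head i) ∧
    ∃ c : Arrow β, Promotes i a c ∧ T' = (T \ shadow i a) ∪ shadow i c

end Arrow

namespace BasisSet

variable {r : ℕ} (β : BasisSet r)

/-- The `x_i`-width: the least `w` with `x_i^w ∉ β`. -/
noncomputable def width (i : Fin r) : ℕ := sInf {w | Finsupp.single i w ∉ β.monos}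

/-- The arrows whose tail is the `i`-th corner monomial `x_i^{w_i}` and whose offset is `v`. -/
def initialSet (i : Fin r) (v : {k : Fin r // k ≠ i} → ℤ) : Set (Arrow β) :=
  {a | a.tail = Finsupp.single i (β.width i) ∧ a.offset i = v}

/-- `T` is a final outcome of iterated shadow promotion from the `x_i`-standard arrows with tail
the `i`-th corner monomial and offset `v`. -/
def IsIteratedPromotion (i : Fin r) (v : {k : Fin r // k ≠ i} → ℤ) (T : Set (Arrow β)) : Prop :=
  Relation.ReflTransGen (Arrow.PromotionRound i) (β.initialSet i v) T ∧
    ∀ a ∈ T, ¬ a.CanAdvance i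

/-- A standard `x_i`-sub-bunch: a union, over all offsets `v`, of outcomes of iterated shadow
promotion. (If `v` is not the offset of an arrow at the corner, its only outcome is empty.) -/
def IsStandardSubBunch (i : Fin r) (S : Set (Arrow β)) : Prop :=
  ∃ T : ({k : Fin r // k ≠ i} → ℤ) → Set (Arrow β),
    (∀ v, β.IsIteratedPromotion i v (T v)) ∧ S = ⋃ v, T v

/-- A standard bunch: a union of standard `x_i`-sub-bunches, one for each variable `x_i`. -/
def IsStandardBunch (S : Set (Arrow β)) : Prop :=
  ∃ T : Fin r → Set (Arrow β), (∀ i, β.IsStandardSubBunch i (T i)) ∧ S = ⋃ i, T i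

end BasisSet

section CoordinateRing

variable (K : Type u) [Field K] {r : ℕ} (β : BasisSet r)

/-- The monomial ideal `I_β ⊆ K[x_1, …, x_r]` generated by the monomials not in `β`. -/
noncomputable def monomialIdeal : Ideal (MvPolynomial (Fin r) K) :=
  Ideal.span {f | ∃ d : Fin r →₀ ℕ, d ∉ β.monos ∧ f = monomial d 1}

/-- The indeterminate `C^d_j` if `x^d ∉ β`; the constant `1` or `0` if `x^d ∈ β`, according to
whether `d = j`. -/
noncomputable def coeffPoly (d : Fin r →₀ ℕ) (j : β.monos) : MvPolynomial (Arrow β) K :=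
  if h : d ∈ β.monos then (if d = j then 1 else 0)
  else X { tail := d, head := j, tail_notMem := h, head_mem := j.2 }

/-- The relation `C^{d'}_{j₀} - ∑_{j ∈ β} C^d_j C^{j'}_{j₀}` with `x^{d'} = x_i x^d` and
`x^{j'} = x_i x^j`. -/
noncomputable def tau (d : Fin r →₀ ℕ) (i : Fin r) (j₀ : β.monos) : MvPolynomial (Arrow β) K :=
  coeffPoly K β (d + Finsupp.single i 1) j₀ -
    ∑ j : β.monos, coeffPoly K β d j * coeffPoly K β ((j : Fin r →₀ ℕ) + Finsupp.single i 1) j₀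

noncomputable def relationIdeal : Ideal (MvPolynomial (Arrow β) K) :=
  Ideal.span {f | ∃ d : Fin r →₀ ℕ, d ∉ β.monos ∧ ∃ i j₀, f = tau K β d i j₀}

/-- The coordinate ring `R` of the affine chart `U_β` of the Hilbert scheme of points. -/
abbrev CoordRing : Type u := MvPolynomial (Arrow β) K ⧸ relationIdeal K β

variable {β} in
/-- The coordinate function `c^d_j ∈ R` of an arrow. -/
noncomputable def arrowFn (a : Arrow β) : CoordRing K β :=
  Ideal.Quotient.mk (relationIdeal K β) (X a)

/-- The ideal of `R[x]` of the universal family over `U_β`, generated by the polynomials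
`x^d - ∑_{j ∈ β} c^d_j x^j`. -/
noncomputable def universalIdeal : Ideal (MvPolynomial (Fin r) (CoordRing K β)) :=
  Ideal.span {f | ∃ d : Fin r →₀ ℕ, f = monomial d 1 -
    ∑ j : β.monos, monomial (j : Fin r →₀ ℕ)
      (Ideal.Quotient.mk (relationIdeal K β) (coeffPoly K β d j))}

/-- `A[x]/J` is a free `A`-module with basis `β`. -/
def HasBasis {A : Type u} [CommRing A] (J : Ideal (MvPolynomial (Fin r) A)) : Prop :=
  LinearIndependent A
      (fun j : β.monos => Ideal.Quotient.mk J (monomial (j : Fin r →₀ ℕ) (1 : A))) ∧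
    Submodule.span A (Set.range
      (fun j : β.monos => Ideal.Quotient.mk J (monomial (j : Fin r →₀ ℕ) (1 : A)))) = ⊤

/-- `Spec R` with the family defined by `I ⊆ R[x]` is `U_β` with its universal family: it represents
the functor sending a `K`-algebra `A` to the set of ideals `J ⊆ A[x]` such that `A[x]/J` is free
with basis `β`. -/
def IsUniversalFamily (R : Type u) [CommRing R] [Algebra K R]
    (I : Ideal (MvPolynomial (Fin r) R)) : Prop :=
  HasBasis β I ∧
    ∀ (A : Type u) [CommRing A] [Algebra K A] (J : Ideal (MvPolynomial (Fin r) A)),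
      HasBasis β J →
        ∃! φ : R →ₐ[K] A, I.map (MvPolynomial.map (φ : R →+* A)) = J

variable {K β} in
theorem aeval_zero_coeffPoly {d : Fin r →₀ ℕ} (hd : d ∉ β.monos) (j : β.monos) :
    aeval (fun _ : Arrow β => (0 : K)) (coeffPoly K β d j) = 0 := by
  simp [coeffPoly, hd]

theorem aeval_zero_of_mem_relationIdeal (f : MvPolynomial (Arrow β) K)
    (hf : f ∈ relationIdeal K β) : aeval (fun _ : Arrow β => (0 : K)) f = 0 := by
  have h : relationIdeal K β ≤ RingHom.ker (aeval (R := K) (fun _ : Arrow β => (0 : K))) := by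
    refine Ideal.span_le.2 ?_
    rintro _ ⟨d, hd, i, j₀, rfl⟩
    have hd' : d + Finsupp.single i 1 ∉ β.monos := fun h => hd (β.mem_of_le h le_self_add)
    simp only [tau, SetLike.mem_coe, RingHom.mem_ker, map_sub, map_sum, map_mul,
      aeval_zero_coeffPoly hd, aeval_zero_coeffPoly hd', zero_mul, Finset.sum_const_zero, sub_zero]
  exact h hf

/-- The `K`-point `t_β` of `U_β = Spec R`, at which all the functions `c^d_j` vanish. -/
noncomputable def originPoint : CoordRing K β →ₐ[K] K :=
  Ideal.Quotient.liftₐ (relationIdeal K β) (aeval (fun _ : Arrow β => (0 : K)))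
    (aeval_zero_of_mem_relationIdeal K β)

/-- The maximal ideal `M ⊆ R` of the point `t_β`. -/
noncomputable def originIdeal : Ideal (CoordRing K β) := RingHom.ker (originPoint K β)

instance originIdeal_isPrime : (originIdeal K β).IsPrime :=
  RingHom.ker_isPrime (originPoint K β)

variable {β} in
theorem arrowFn_mem (a : Arrow β) : arrowFn K a ∈ originIdeal K β := by
  change originPoint K β (arrowFn K a) = 0
  simp [originPoint, arrowFn]

variable {β} in
/-- The class of the arrow `c^d_j` in the cotangent space `M/M²`. -/
noncomputable def arrowClass (a : Arrow β) : (originIdeal K β).Cotangent :=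
  (originIdeal K β).toCotangent ⟨arrowFn K a, arrowFn_mem K a⟩

/-- `t_β` is a nonsingular point: its local ring is a regular local ring. -/
def IsNonsingularPoint : Prop := IsRegularLocalRing (Localization.AtPrime (originIdeal K β))

end CoordinateRing

/-!
An arrow that is not `∼ 0` has a translation class whose indicator function is a tangent vector at
`t_β`, so non-advanceable arrows in distinct classes are independent in `M / M²`. Shadow promotion
never changes, within one offset, the number of arrows, and it terminates because it lowers heights;
the final sets therefore contain one arrow for each variable and each monomial of `β`.

For the criterion of nonsingularity let `P` be the kernel of the map from `R` to the coordinate ring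
of the space of `n` points in affine space on which the monomials of `β` are independent. It is a
prime ideal with `dim R / P = rn`, and `P ⊆ M` because a grid of shape `β` contracts to the origin,
so `M` has height at least `rn`. Over an algebraic closure, a point of `U_β` where the discriminant
of the universal family does not vanish is a set of `n` points, so `P` is a minimal prime. If `R_M`
is regular, it is a domain, so `P` is the only component through `t_β` and
`dim M / M² = height M = rn`.
-/

/-! ### Translation and shadows of arrows -/

namespace Arrow

variable {r : ℕ} {β : BasisSet r} {i : Fin r} {a b c p : Arrow β}

theorem Step.symm (h : Step a b) : Step b a :=
  h.imp fun _ => Or.symm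

theorem TransEquiv.symm (h : TransEquiv a b) : TransEquiv b a := by
  induction h with
  | refl => exact .refl
  | tail _ hs ih => exact ih.head hs.symm

theorem Step.head_add_tail (h : Step a b) (k : Fin r) :
    a.head k + b.tail k = b.head k + a.tail k := by
  obtain ⟨i, ⟨ht, hh⟩ | ⟨ht, hh⟩⟩ := h <;> simp only [ht, hh, Finsupp.add_apply] <;> omega

theorem TransEquiv.head_add_tail (h : TransEquiv a b) (k : Fin r) :
    a.head k + b.tail k = b.head k + a.tail k := by
  induction h with
  | refl => rfl
  | tail _ hs ih => have := hs.head_add_tail k; omega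

theorem offset_eq_iff :
    a.offset i = b.offset i ↔ ∀ k, k ≠ i → a.head k + b.tail k = b.head k + a.tail k := by
  simp only [funext_iff, offset, Subtype.forall]
  exact forall₂_congr fun k _ => by omega

theorem TransEquiv.offset_eq (h : TransEquiv a b) (i : Fin r) : a.offset i = b.offset i :=
  offset_eq_iff.2 fun k _ => h.head_add_tail k

theorem isStandardFor_iff_offset_nonneg : a.IsStandardFor i ↔ 0 ≤ a.offset i := by
  have hoff : 0 ≤ a.offset i ↔ ∀ k, k ≠ i → a.tail k ≤ a.head k := by
    simp only [Pi.le_def, Subtype.forall, offset, Pi.zero_apply, sub_nonneg, Nat.cast_le]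
  refine ⟨fun h => hoff.2 h.2, fun h => ⟨?_, hoff.1 h⟩⟩
  -- otherwise the tail would divide the head
  by_contra! hi
  refine a.tail_notMem (β.mem_of_le a.head_mem fun k => ?_)
  obtain rfl | hk := eq_or_ne k i
  exacts [hi, hoff.1 h k hk]

theorem IsStandardFor.of_offset_eq (ha : a.IsStandardFor i) (h : a.offset i = b.offset i) :
    b.IsStandardFor i := by
  rwa [isStandardFor_iff_offset_nonneg, ← h, ← isStandardFor_iff_offset_nonneg]

theorem IsStandardFor.unique {k : Fin r} (hi : a.IsStandardFor i) (hk : a.IsStandardFor k) :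
    i = k := by
  by_contra h
  exact (hi.1.trans_le (hk.2 i h)).false

theorem mem_shadow_iff :
    b ∈ shadow i a ↔ b.tail = a.tail ∧ b.offset i = a.offset i ∧ b.head i ≤ a.head i := by
  rw [offset_eq_iff]
  refine and_congr_right fun ht => ?_
  simp only [ht, add_left_inj]
  constructor
  · rintro ⟨s, hs⟩
    exact ⟨fun k hk => by simp [hs, Finsupp.single_eq_of_ne hk], by simp [hs]⟩
  · rintro ⟨hne, hi⟩
    refine ⟨a.head i - b.head i, Finsupp.ext fun k => ?_⟩
    obtain rfl | hk := eq_or_ne k i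
    · simp [hi]
    · simp [Finsupp.single_eq_of_ne hk, hne k hk]

/-! ### Promotion of a shadow -/

theorem IsFirstExit.transEquiv (h : IsFirstExit i a p) : TransEquiv a p :=
  Relation.ReflTransGen.mono (fun _ _ h => h.1) _ _ h.1

theorem exists_isFirstExit_of_isExit (h : TransEquiv a p) (hp : IsExit i a p) :
    ∃ q, IsFirstExit i a q := by
  by_contra! hne
  have hpath : ∀ q, TransEquiv a q →
      Relation.ReflTransGen (fun q q' => Step q q' ∧ ¬ IsExit i a q) a q := by
    intro q hq
    induction hq with
    | refl => exact .refl
    | tail _ hs ih => exact ih.tail ⟨hs, fun he => hne _ ⟨ih, he⟩⟩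
  exact hne p ⟨hpath p h, hp⟩

theorem exists_isExit_of_tail_lt (h : TransEquiv a b) (hlt : b.tail i < a.tail i) :
    ∃ p, TransEquiv a p ∧ IsExit i a p := by
  induction h with
  | refl => omega
  | @tail c d hc hs ih =>
    by_cases hci : c.tail i < a.tail i
    · exact ih hci
    obtain ⟨k, ⟨ht, -⟩ | ⟨ht, -⟩⟩ := hs <;> obtain rfl | hk := eq_or_ne k i <;>
      simp only [ht, Finsupp.add_apply, Finsupp.single_eq_same] at hlt hci
    · omega
    · omega
    · exact ⟨c, hc, by simp only [ht, Finsupp.add_apply, Finsupp.single_eq_same]; omega,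
        d.tail, d.tail_notMem, ht⟩
    · rw [Finsupp.single_eq_of_ne' hk] at hci
      omega

theorem IsStandardFor.eq_of_head_eq_zero {k : Fin r} (ha : a.IsStandardFor i)
    (hk : a.head k = 0) (hdrop : TailCanDrop k a) : k = i := by
  by_contra hki
  obtain ⟨m, -, hm⟩ := hdrop
  have := ha.2 k hki
  simp [hm, hk] at this

theorem CanAdvance.exists_isFirstExit (ha : a.IsStandardFor i) (h : a.CanAdvance i) :
    ∃ p, IsFirstExit i a p := by
  obtain ⟨p, hp, hpe⟩ : ∃ p, TransEquiv a p ∧ IsExit i a p := by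
    obtain ⟨b, hb, k, hk, hdrop⟩ | ⟨b, hb, hlt⟩ := h
    · by_cases hlt : b.tail i < a.tail i
      · exact exists_isExit_of_tail_lt hb hlt
      obtain rfl := (ha.of_offset_eq (hb.offset_eq i)).eq_of_head_eq_zero hk hdrop
      have := hb.head_add_tail k
      exact ⟨b, hb, by omega, hdrop⟩
    · exact exists_isExit_of_tail_lt hb hlt
  exact exists_isFirstExit_of_isExit hp hpe

theorem exists_promotes (ha : a.IsStandardFor i) (h : a.CanAdvance i) : ∃ c, Promotes i a c := by
  obtain ⟨p, hp⟩ := h.exists_isFirstExit ha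
  have hps := ha.of_offset_eq (hp.transEquiv.offset_eq i)
  obtain ⟨m, hm, hpm⟩ := hp.2.2
  obtain ⟨b, hbm, hb⟩ := exists_minimal_le_of_wellFoundedLT (fun d => d ∉ β.monos) m hm
  have hbp : b + Finsupp.single i 1 ≤ p.tail := hpm ▸ add_le_add_left hbm _
  let j : Fin r →₀ ℕ := Finsupp.equivFunOnFinite.symm
    fun k => if k = i then p.head i else p.head k - (p.tail k - b k)
  have hj : j ∈ β.monos := β.mem_of_le p.head_mem fun k => by
    obtain rfl | hk := eq_or_ne k i <;> simp [j, *]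
  refine ⟨⟨b, j, hb.prop, hj⟩, p, hp, hb, hbp, by simp [j], fun k hk => ?_⟩
  have := hps.2 k hk
  have := (le_self_add.trans hbp) k
  simp only [j, Finsupp.equivFunOnFinite_symm_apply_apply, hk, if_false]
  omega

theorem Promotes.isMinimal (h : Promotes i a c) : c.IsMinimal := by
  obtain ⟨p, -, hc, -⟩ := h
  exact hc

theorem Promotes.head_eq (h : Promotes i a c) : c.head i = a.head i := by
  obtain ⟨p, hp, -, -, hc, -⟩ := h
  have := hp.transEquiv.head_add_tail i
  have := hp.2.1
  omega

theorem Promotes.tail_lt (h : Promotes i a c) : c.tail i < a.tail i := by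
  obtain ⟨p, hp, -, hle, -⟩ := h
  have := hle i
  rw [Finsupp.add_apply, Finsupp.single_eq_same, hp.2.1] at this
  exact this

theorem Promotes.offset_eq (h : Promotes i a c) : c.offset i = a.offset i := by
  obtain ⟨p, hp, -, -, -, hc⟩ := h
  exact (offset_eq_iff.2 hc).trans (hp.transEquiv.offset_eq i).symm

end Arrow

/-! ### Footprints of arrows -/

/-- The monomials of `β` whose exponents in the variables other than `x_i` are given by `v`. -/
def BasisSet.column {r : ℕ} (β : BasisSet r) (i : Fin r) (v : {k : Fin r // k ≠ i} → ℤ) :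
    Set (Fin r →₀ ℕ) :=
  {j | j ∈ β.monos ∧ ∀ k : {k : Fin r // k ≠ i}, (j k : ℤ) = v k}

namespace Arrow

variable {r : ℕ} {β : BasisSet r} {i : Fin r} {a b : Arrow β}

/-- The exponent vector that an `x_i`-standard arrow is charged to when a standard bunch is
counted: the `x_i`-degree of the head, and the `x_i`-offset in the other variables. The truncated
subtraction is exact on `x_i`-standard arrows, the only ones for which this notion is meant. -/
noncomputable def footprint (i : Fin r) (a : Arrow β) : Fin r →₀ ℕ :=
  Finsupp.equivFunOnFinite.symm fun k => if k = i then a.head i else a.head k - a.tail k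

@[simp]
theorem footprint_self (i : Fin r) (a : Arrow β) : footprint i a i = a.head i := by
  simp [footprint]

theorem footprint_mem (i : Fin r) (a : Arrow β) : footprint i a ∈ β.monos :=
  β.mem_of_le a.head_mem fun k => by
    obtain rfl | hk := eq_or_ne k i <;> simp [footprint, *]

theorem IsStandardFor.footprint_of_ne (ha : a.IsStandardFor i) (k : {k : Fin r // k ≠ i}) :
    (footprint i a k : ℤ) = a.offset i k := by
  have := ha.2 k k.2
  simp only [footprint, Finsupp.equivFunOnFinite_symm_apply_apply, k.2, if_false, offset]
  omega

theorem IsStandardFor.footprint_mem_column (ha : a.IsStandardFor i) :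
    footprint i a ∈ β.column i (a.offset i) :=
  ⟨footprint_mem i a, ha.footprint_of_ne⟩

theorem IsStandardFor.footprint_eq_iff (ha : a.IsStandardFor i) {j : Fin r →₀ ℕ}
    (hj : j ∈ β.column i (a.offset i)) : footprint i a = j ↔ a.head i = j i := by
  refine ⟨fun h => by rw [← h, footprint_self], fun h => Finsupp.ext fun k => ?_⟩
  obtain rfl | hk := eq_or_ne k i
  · rw [footprint_self, h]
  · exact Int.ofNat.inj ((ha.footprint_of_ne ⟨k, hk⟩).trans (hj.2 ⟨k, hk⟩).symm)

theorem offset_eq_of_footprint_eq (ha : a.IsStandardFor i) (hb : b.IsStandardFor i)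
    (h : footprint i a = footprint i b) : a.offset i = b.offset i :=
  funext fun k => by rw [← ha.footprint_of_ne, h, hb.footprint_of_ne]

theorem eq_of_tail_eq_of_offset_eq (ht : a.tail = b.tail) (ho : a.offset i = b.offset i)
    (hh : a.head i = b.head i) : a = b := by
  refine Arrow.ext ht (Finsupp.ext fun k => ?_)
  obtain rfl | hk := eq_or_ne k i
  · exact hh
  · simpa [ht] using offset_eq_iff.1 ho k hk

theorem exists_mem_shadow (i : Fin r) (a : Arrow β) {m : ℕ} (hm : m ≤ a.head i) :
    ∃ b ∈ shadow i a, b.head i = m := by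
  refine ⟨⟨a.tail, a.head - Finsupp.single i (a.head i - m), a.tail_notMem,
    β.mem_of_le a.head_mem tsub_le_self⟩, ⟨rfl, a.head i - m, ?_⟩, ?_⟩
  · refine (tsub_add_cancel_of_le ?_).symm
    rw [Finsupp.single_le_iff]
    omega
  · simp only [Finsupp.coe_tsub, Pi.sub_apply, Finsupp.single_eq_same]
    omega

theorem IsStandardFor.footprint_bijOn_shadow (ha : a.IsStandardFor i) :
    Set.BijOn (footprint i) (shadow i a) {j ∈ β.column i (a.offset i) | j i ≤ a.head i} := by
  have hoff {b} (hb : b ∈ shadow i a) : b.offset i = a.offset i := (mem_shadow_iff.1 hb).2.1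
  have hstd {b} (hb : b ∈ shadow i a) : b.IsStandardFor i := ha.of_offset_eq (hoff hb).symm
  refine ⟨fun b hb => ⟨hoff hb ▸ (hstd hb).footprint_mem_column, ?_⟩, fun b hb c hc hbc => ?_,
    fun j hj => ?_⟩
  · rw [footprint_self]
    exact (mem_shadow_iff.1 hb).2.2
  · exact eq_of_tail_eq_of_offset_eq (hb.1.trans hc.1.symm) ((hoff hb).trans (hoff hc).symm)
      (by simpa using DFunLike.congr_fun hbc i)
  · obtain ⟨b, hb, hbj⟩ := exists_mem_shadow i a hj.2
    exact ⟨b, hb, ((hstd hb).footprint_eq_iff (hoff hb ▸ hj.1)).2 hbj⟩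

end Arrow

/-! ### Standard bunches -/

namespace BasisSet

variable {r : ℕ} {β : BasisSet r} {i : Fin r} {v : {k : Fin r // k ≠ i} → ℤ}
  {S T : Set (Arrow β)}

theorem single_width_notMem (β : BasisSet r) (i : Fin r) :
    Finsupp.single i (β.width i) ∉ β.monos := by
  refine Nat.sInf_mem (s := {w | Finsupp.single i w ∉ β.monos}) ?_
  by_contra! h
  refine Set.infinite_of_injective_forall_mem (Finsupp.single_injective i)
    (fun w : ℕ => ?_) β.monos.finite_toSet
  simpa using Set.eq_empty_iff_forall_notMem.1 h w

theorem minimal_single_width (β : BasisSet r) (i : Fin r) :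
    Minimal (fun d => d ∉ β.monos) (Finsupp.single i (β.width i)) := by
  refine ⟨β.single_width_notMem i, fun d hd hle => ?_⟩
  have hd' : d = Finsupp.single i (d i) := by
    ext k
    obtain rfl | hk := eq_or_ne k i
    · simp
    · simpa [Finsupp.single_eq_of_ne hk] using hle k
  rw [hd'] at hd
  rw [Finsupp.single_le_iff]
  exact Nat.sInf_le hd

variable (β) in
/-- The properties shared by all stages of iterated shadow promotion for the offset `v`. By the
last one, the arrows whose heads are at most as high as that of an arrow that can be advanced make
up the shadow of that arrow. -/
structure IsPromotionStage (i : Fin r) (v : {k : Fin r // k ≠ i} → ℤ) (T : Set (Arrow β)) :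
    Prop where
  isMinimal : ∀ a ∈ T, a.IsMinimal
  isStandardFor : ∀ a ∈ T, a.IsStandardFor i
  footprint_bijOn : Set.BijOn (Arrow.footprint i) T (β.column i v)
  tail_eq : ∀ a ∈ T, a.CanAdvance i → ∀ b ∈ T, b.head i ≤ a.head i → b.tail = a.tail

theorem isPromotionStage_initialSet (β : BasisSet r) (i : Fin r) (v : {k : Fin r // k ≠ i} → ℤ) :
    β.IsPromotionStage i v (β.initialSet i v) := by
  have hstd : ∀ a ∈ β.initialSet i v, a.IsStandardFor i := fun a ha =>
    Arrow.isStandardFor_iff_offset_nonneg.2 fun k => by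
      simp [Arrow.offset, ha.1, Finsupp.single_eq_of_ne k.2]
  refine ⟨fun a ha => ?_, hstd, ⟨fun a ha => ha.2 ▸ (hstd a ha).footprint_mem_column,
    fun a ha b hb hab => ?_, fun j hj => ?_⟩, fun a ha _ b hb _ => hb.1.trans ha.1.symm⟩
  · rw [Arrow.IsMinimal, ha.1]
    exact β.minimal_single_width i
  · exact Arrow.eq_of_tail_eq_of_offset_eq (ha.1.trans hb.1.symm) (ha.2.trans hb.2.symm)
      (by simpa using DFunLike.congr_fun hab i)
  · let a : Arrow β := ⟨_, j, β.single_width_notMem i, hj.1⟩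
    have ha : a ∈ β.initialSet i v :=
      ⟨rfl, funext fun k => by simp [a, Arrow.offset, hj.2 k, Finsupp.single_eq_of_ne k.2]⟩
    exact ⟨a, ha, ((hstd a ha).footprint_eq_iff (ha.2.symm ▸ hj)).2 rfl⟩

namespace IsPromotionStage

variable {a b c : Arrow β}

theorem offset_eq (h : β.IsPromotionStage i v T) (ha : a ∈ T) : a.offset i = v :=
  funext fun k => by
    rw [← (h.isStandardFor a ha).footprint_of_ne, (h.footprint_bijOn.mapsTo ha).2]

theorem head_lt_of_notMem_shadow (h : β.IsPromotionStage i v T) (ha : a ∈ T)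
    (hadv : a.CanAdvance i) (hb : b ∈ T) (hba : b ∉ Arrow.shadow i a) : a.head i < b.head i := by
  by_contra! hle
  exact hba (Arrow.mem_shadow_iff.2
    ⟨h.tail_eq a ha hadv b hb hle, (h.offset_eq hb).trans (h.offset_eq ha).symm, hle⟩)

/-- Removing the shadow of `a` and adding that of `c` exchanges two sets with the same footprints,
because promotion preserves offset and `x_i`-degree of the head. -/
theorem footprint_bijOn_promotion (h : β.IsPromotionStage i v T) (ha : a ∈ T)
    (hadv : a.CanAdvance i) (hc : Arrow.Promotes i a c) :
    Set.BijOn (Arrow.footprint i) (T \ Arrow.shadow i a ∪ Arrow.shadow i c) (β.column i v) := by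
  have hlow : Set.BijOn (Arrow.footprint i) (Arrow.shadow i c)
      {j ∈ β.column i v | j i ≤ a.head i} := by
    have hcs := (h.isStandardFor a ha).of_offset_eq hc.offset_eq.symm
    simpa only [hc.offset_eq, hc.head_eq, h.offset_eq ha] using hcs.footprint_bijOn_shadow
  have hhigh : Set.BijOn (Arrow.footprint i) (T \ Arrow.shadow i a)
      {j ∈ β.column i v | a.head i < j i} := by
    refine ⟨fun b hb => ⟨h.footprint_bijOn.mapsTo hb.1, ?_⟩,
      h.footprint_bijOn.injOn.mono Set.sdiff_subset, fun j hj => ?_⟩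
    · rw [Arrow.footprint_self]
      exact h.head_lt_of_notMem_shadow ha hadv hb.1 hb.2
    · obtain ⟨b, hb, rfl⟩ := h.footprint_bijOn.surjOn hj.1
      have hab := hj.2
      rw [Arrow.footprint_self] at hab
      exact ⟨b, ⟨hb, fun hba => hab.not_ge (Arrow.mem_shadow_iff.1 hba).2.2⟩, rfl⟩
  have hcol : β.column i v =
      {j ∈ β.column i v | a.head i < j i} ∪ {j ∈ β.column i v | j i ≤ a.head i} := by
    ext j
    simp only [Set.mem_union, Set.mem_sep_iff, ← and_or_left, lt_or_ge, and_true]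
  rw [hcol]
  have hne : ∀ b ∈ T \ Arrow.shadow i a, ∀ d ∈ Arrow.shadow i c,
      Arrow.footprint i b ≠ Arrow.footprint i d := fun b hb d hd hbd =>
    (hhigh.mapsTo hb).2.not_ge (hbd ▸ (hlow.mapsTo hd).2)
  have hdisj : Disjoint (T \ Arrow.shadow i a) (Arrow.shadow i c) :=
    Set.disjoint_left.2 fun b hb hd => hne b hb b hd rfl
  exact hhigh.union hlow ((Set.injOn_union hdisj).2 ⟨hhigh.injOn, hlow.injOn, hne⟩)

theorem mem_shadow_of_canAdvance (h : β.IsPromotionStage i v T) (ha : a ∈ T)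
    (hadv : a.CanAdvance i) (hmax : ∀ b ∈ T, b.CanAdvance i → b.head i ≤ a.head i)
    (hb : b ∈ T \ Arrow.shadow i a ∪ Arrow.shadow i c) (hbadv : b.CanAdvance i) :
    b ∈ Arrow.shadow i c :=
  hb.resolve_left fun hb =>
    (h.head_lt_of_notMem_shadow ha hadv hb.1 hb.2).not_ge (hmax b hb.1 hbadv)

theorem promotion (h : β.IsPromotionStage i v T) (ha : a ∈ T) (hadv : a.CanAdvance i)
    (hmax : ∀ b ∈ T, b.CanAdvance i → b.head i ≤ a.head i) (hc : Arrow.Promotes i a c) :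
    β.IsPromotionStage i v (T \ Arrow.shadow i a ∪ Arrow.shadow i c) where
  isMinimal := by
    rintro b (hb | hb)
    · exact h.isMinimal b hb.1
    · rw [Arrow.IsMinimal, hb.1]
      exact hc.isMinimal
  isStandardFor := by
    rintro b (hb | hb)
    · exact h.isStandardFor b hb.1
    · exact (h.isStandardFor a ha).of_offset_eq
        (hc.offset_eq.symm.trans (Arrow.mem_shadow_iff.1 hb).2.1.symm)
  footprint_bijOn := h.footprint_bijOn_promotion ha hadv hc
  tail_eq b hb hbadv b' hb' hle := by
    have hbc := h.mem_shadow_of_canAdvance ha hadv hmax hb hbadv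
    have hba : b.head i ≤ a.head i := hc.head_eq ▸ (Arrow.mem_shadow_iff.1 hbc).2.2
    obtain hb' | hb' := hb'
    · exact absurd (hle.trans hba) (h.head_lt_of_notMem_shadow ha hadv hb'.1 hb'.2).not_ge
    · exact hb'.1.trans hbc.1.symm

theorem finite (h : β.IsPromotionStage i v T) : T.Finite :=
  h.footprint_bijOn.finite_iff_finite.2 (β.monos.finite_toSet.subset fun _ hj => hj.1)

/-- In each round the height of the arrows that can be advanced drops. -/
theorem exists_final (h : β.IsPromotionStage i v T) (N : ℕ)
    (hN : ∀ a ∈ T, a.CanAdvance i → a.tail i ≤ N) :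
    ∃ T', Relation.ReflTransGen (Arrow.PromotionRound i) T T' ∧ ∀ a ∈ T', ¬ a.CanAdvance i := by
  induction N generalizing T with
  | zero =>
    refine ⟨T, .refl, fun a ha hadv => ?_⟩
    exact (h.isStandardFor a ha).1.not_ge ((hN a ha hadv).trans (Nat.zero_le _))
  | succ N ih =>
    by_cases! hT : ∀ a ∈ T, ¬ a.CanAdvance i
    · exact ⟨T, .refl, hT⟩
    obtain ⟨a, ⟨haT, hadv⟩, hmax⟩ := Set.exists_max_image {a ∈ T | a.CanAdvance i}
      (fun a => a.head i) (h.finite.subset fun _ ha => ha.1) hT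
    replace hmax : ∀ b ∈ T, b.CanAdvance i → b.head i ≤ a.head i := fun b hb hb' =>
      hmax b ⟨hb, hb'⟩
    obtain ⟨c, hc⟩ := Arrow.exists_promotes (h.isStandardFor a haT) hadv
    obtain ⟨T', hround, hT'⟩ := ih (h.promotion haT hadv hmax hc) fun b hb hbadv => by
      rw [(h.mem_shadow_of_canAdvance haT hadv hmax hb hbadv).1]
      exact Nat.le_of_lt_succ (hc.tail_lt.trans_le (hN a haT hadv))
    exact ⟨T', hround.head ⟨a, haT, hadv, hmax, c, hc, rfl⟩, hT'⟩

end IsPromotionStage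

theorem IsIteratedPromotion.isPromotionStage (h : β.IsIteratedPromotion i v T) :
    β.IsPromotionStage i v T := by
  obtain ⟨h, -⟩ := h
  induction h with
  | refl => exact β.isPromotionStage_initialSet i v
  | tail _ hround ih =>
    obtain ⟨a, ha, hadv, hmax, c, hc, rfl⟩ := hround
    exact ih.promotion ha hadv hmax hc

theorem exists_isIteratedPromotion (β : BasisSet r) (i : Fin r) (v : {k : Fin r // k ≠ i} → ℤ) :
    ∃ T, β.IsIteratedPromotion i v T :=
  (β.isPromotionStage_initialSet i v).exists_final (β.width i) fun a ha _ => by simp [ha.1]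

theorem exists_isStandardBunch (β : BasisSet r) : ∃ S, β.IsStandardBunch S := by
  choose T hT using β.exists_isIteratedPromotion
  exact ⟨_, _, fun i => ⟨T i, hT i, rfl⟩, rfl⟩

namespace IsStandardSubBunch

variable {a b : Arrow β}

theorem isMinimal (h : β.IsStandardSubBunch i S) (ha : a ∈ S) : a.IsMinimal := by
  obtain ⟨T, hT, rfl⟩ := h
  obtain ⟨v, hv⟩ := Set.mem_iUnion.1 ha
  exact (hT v).isPromotionStage.isMinimal a hv

theorem isStandardFor (h : β.IsStandardSubBunch i S) (ha : a ∈ S) : a.IsStandardFor i := by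
  obtain ⟨T, hT, rfl⟩ := h
  obtain ⟨v, hv⟩ := Set.mem_iUnion.1 ha
  exact (hT v).isPromotionStage.isStandardFor a hv

theorem not_canAdvance (h : β.IsStandardSubBunch i S) (ha : a ∈ S) : ¬ a.CanAdvance i := by
  obtain ⟨T, hT, rfl⟩ := h
  obtain ⟨v, hv⟩ := Set.mem_iUnion.1 ha
  exact (hT v).2 a hv

theorem footprint_bijOn (h : β.IsStandardSubBunch i S) :
    Set.BijOn (Arrow.footprint i) S (β.monos : Set (Fin r →₀ ℕ)) := by
  have hstd {a : Arrow β} (ha : a ∈ S) := h.isStandardFor ha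
  obtain ⟨T, hT, rfl⟩ := h
  have hst v := (hT v).isPromotionStage
  refine ⟨fun a _ => Arrow.footprint_mem i a, fun a ha b hb hab => ?_, fun j hj => ?_⟩
  · have hoff := Arrow.offset_eq_of_footprint_eq (hstd ha) (hstd hb) hab
    obtain ⟨v, hv⟩ := Set.mem_iUnion.1 ha
    obtain ⟨w, hw⟩ := Set.mem_iUnion.1 hb
    rw [(hst v).offset_eq hv, (hst w).offset_eq hw] at hoff
    subst hoff
    exact (hst v).footprint_bijOn.injOn hv hw hab
  · obtain ⟨a, ha, haj⟩ := (hst fun k => (j k : ℤ)).footprint_bijOn.surjOn ⟨hj, fun _ => rfl⟩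
    exact ⟨a, Set.mem_iUnion.2 ⟨_, ha⟩, haj⟩

theorem eq_of_transEquiv (h : β.IsStandardSubBunch i S) (ha : a ∈ S) (hb : b ∈ S)
    (hab : a.TransEquiv b) : a = b := by
  have hlt : ¬ b.tail i < a.tail i := fun hlt => h.not_canAdvance ha (.inr ⟨b, hab, hlt⟩)
  have hgt : ¬ a.tail i < b.tail i := fun hgt => h.not_canAdvance hb (.inr ⟨a, hab.symm, hgt⟩)
  have hhead : a.head i = b.head i := by have := hab.head_add_tail i; omega
  refine h.footprint_bijOn.injOn ha hb (((h.isStandardFor ha).footprint_eq_iff ?_).2 ?_)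
  · exact hab.offset_eq i ▸ (h.isStandardFor hb).footprint_mem_column
  · rw [hhead, Arrow.footprint_self]

end IsStandardSubBunch

namespace IsStandardBunch

variable {a b : Arrow β}

theorem isMinimal_and_isStandard (h : β.IsStandardBunch S) (ha : a ∈ S) :
    a.IsMinimal ∧ a.IsStandard := by
  obtain ⟨T, hT, rfl⟩ := h
  obtain ⟨i, hi⟩ := Set.mem_iUnion.1 ha
  exact ⟨(hT i).isMinimal hi, i, (hT i).isStandardFor hi⟩

theorem not_equivZero (h : β.IsStandardBunch S) (ha : a ∈ S) : ¬ a.EquivZero := by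
  obtain ⟨T, hT, rfl⟩ := h
  obtain ⟨i, hi⟩ := Set.mem_iUnion.1 ha
  exact fun hzero => (hT i).not_canAdvance hi (.inl hzero)

theorem eq_of_transEquiv (h : β.IsStandardBunch S) (ha : a ∈ S) (hb : b ∈ S)
    (hab : a.TransEquiv b) : a = b := by
  obtain ⟨T, hT, rfl⟩ := h
  obtain ⟨i, hi⟩ := Set.mem_iUnion.1 ha
  obtain ⟨k, hk⟩ := Set.mem_iUnion.1 hb
  obtain rfl := (((hT i).isStandardFor hi).of_offset_eq (hab.offset_eq i)).unique
    ((hT k).isStandardFor hk)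
  exact (hT i).eq_of_transEquiv hi hk hab

theorem nonempty_equiv (h : β.IsStandardBunch S) : Nonempty (S ≃ Fin r × β.monos) := by
  obtain ⟨T, hT, rfl⟩ := h
  have hdisj : Pairwise (Function.onFun Disjoint T) := fun i k hik =>
    Set.disjoint_left.2 fun a ha hk =>
      hik (((hT i).isStandardFor ha).unique ((hT k).isStandardFor hk))
  exact ⟨(Set.unionEqSigmaOfDisjoint hdisj).trans <|
    (Equiv.sigmaCongrRight fun i => (hT i).footprint_bijOn.equiv).trans <|
      Equiv.sigmaEquivProd _ _⟩

theorem finite (h : β.IsStandardBunch S) : S.Finite :=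
  h.nonempty_equiv.elim fun e => Finite.of_equiv _ e.symm

theorem ncard_eq (h : β.IsStandardBunch S) : S.ncard = r * β.monos.card := by
  obtain ⟨e⟩ := h.nonempty_equiv
  rw [← Nat.card_coe_set_eq, Nat.card_congr e]
  simp

end IsStandardBunch

end BasisSet

/-! ### Expansions in the basis of monomials -/

theorem exponent_induction {σ : Type*} {P : (σ →₀ ℕ) → Prop} (zero : P 0)
    (add_single : ∀ d i, P d → P (d + Finsupp.single i 1)) (d : σ →₀ ℕ) : P d := by
  classical
  induction d using Finsupp.induction₂ with
  | zero => exact zero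
  | add_single i n d _ _ ih =>
    clear * - add_single ih
    induction n with
    | zero => simpa only [Finsupp.single_zero, add_zero] using ih
    | succ n hn => simpa only [Finsupp.single_add, ← add_assoc] using add_single _ i hn

/-- The value of the monomial `x^d` at the tuple `x`. -/
def monomialValue {r : ℕ} {B : Type*} [CommMonoid B] (x : Fin r → B) (d : Fin r →₀ ℕ) : B :=
  ∏ i, x i ^ d i

section MonomialValue

variable {r : ℕ} {B : Type*} [CommMonoid B]

theorem monomialValue_add (x : Fin r → B) (d e : Fin r →₀ ℕ) :
    monomialValue x (d + e) = monomialValue x d * monomialValue x e := by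
  simp only [monomialValue, Finsupp.add_apply, pow_add, Finset.prod_mul_distrib]

theorem monomialValue_add_single (x : Fin r → B) (d : Fin r →₀ ℕ) (i : Fin r) :
    monomialValue x (d + Finsupp.single i 1) = x i * monomialValue x d := by
  rw [monomialValue_add, mul_comm]
  simp only [monomialValue, Finsupp.single_apply, pow_ite, pow_one, pow_zero, Finset.prod_ite_eq,
    Finset.mem_univ, if_true]

theorem map_monomialValue {F C : Type*} [CommMonoid C] [FunLike F B C] [MonoidHomClass F B C]
    (φ : F) (x : Fin r → B) (d : Fin r →₀ ℕ) :
    φ (monomialValue x d) = monomialValue (fun i => φ (x i)) d := by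
  simp only [monomialValue, map_prod, map_pow]

theorem aeval_monomial_eq_smul {A B : Type*} [CommSemiring A] [CommSemiring B] [Algebra A B]
    (x : Fin r → B) (d : Fin r →₀ ℕ) (a : A) :
    aeval x (monomial d a) = a • monomialValue x d := by
  rw [aeval_monomial, Algebra.smul_def, monomialValue, Finsupp.prod_fintype _ _ fun _ => pow_zero _]

end MonomialValue

variable {r : ℕ} {β : BasisSet r}

/-- `γ` is the system of coefficients of an expansion of monomials in the basis `β` with values in
`A`: the monomials of `β` are basis vectors, and multiplication by `x_i` is consistent. These
systems are the `A`-valued points of `U_β`. -/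
structure IsCoeffSystem {A : Type*} [CommRing A] (γ : (Fin r →₀ ℕ) → β.monos → A) : Prop where
  apply_coe : ∀ j : β.monos, γ j = Pi.single j 1
  apply_add_single : ∀ d i j₀, γ (d + Finsupp.single i 1) j₀ =
    ∑ j : β.monos, γ d j * γ ((j : Fin r →₀ ℕ) + Finsupp.single i 1) j₀

/-- In the `A`-algebra `B` all monomials in the `x_i` are combinations of those in `β`, with the
coefficients `γ`. -/
def Expands {A B : Type*} [CommRing A] [CommRing B] [Algebra A B]
    (γ : (Fin r →₀ ℕ) → β.monos → A) (x : Fin r → B) : Prop :=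
  ∀ d, monomialValue x d = ∑ j : β.monos, γ d j • monomialValue x (j : Fin r →₀ ℕ)

/-- The expansion of polynomials in the basis `β` given by the coefficients `γ` of monomials. -/
noncomputable def basisCoords {A : Type*} [CommRing A] (γ : (Fin r →₀ ℕ) → β.monos → A) :
    MvPolynomial (Fin r) A →ₗ[A] (β.monos → A) :=
  (basisMonomials (Fin r) A).constr A γ

/-- The ideal generated by the polynomials `x^d - ∑_{j ∈ β} γ^d_j x^j`. -/
noncomputable def coeffIdeal {A : Type*} [CommRing A] (γ : (Fin r →₀ ℕ) → β.monos → A) :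
    Ideal (MvPolynomial (Fin r) A) :=
  Ideal.span {f | ∃ d : Fin r →₀ ℕ, f = monomial d 1 -
    ∑ j : β.monos, monomial (j : Fin r →₀ ℕ) (γ d j)}

section Expansion

variable {A : Type*} [CommRing A] {γ γ' : (Fin r →₀ ℕ) → β.monos → A}

theorem basisCoords_monomial (γ : (Fin r →₀ ℕ) → β.monos → A) (d : Fin r →₀ ℕ) (a : A) :
    basisCoords γ (monomial d a) = a • γ d := by
  have h := (basisMonomials (Fin r) A).constr_basis A γ d
  rw [coe_basisMonomials] at h
  rw [← mul_one a, ← smul_eq_mul, ← smul_monomial, map_smul, basisCoords, h, smul_eq_mul, mul_one]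

namespace IsCoeffSystem

theorem map {B : Type*} [CommRing B] (h : IsCoeffSystem γ) (φ : A →+* B) :
    IsCoeffSystem fun d j => φ (γ d j) where
  apply_coe j := funext fun l => by simp [h.apply_coe, Pi.single_apply, apply_ite φ]
  apply_add_single d i j₀ := by simp [h.apply_add_single d i j₀]

theorem of_notMem (hmem : ∀ j : β.monos, γ j = Pi.single j 1)
    (hadd : ∀ d, d ∉ β.monos → ∀ i j₀, γ (d + Finsupp.single i 1) j₀ =
      ∑ j : β.monos, γ d j * γ ((j : Fin r →₀ ℕ) + Finsupp.single i 1) j₀) :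
    IsCoeffSystem γ := by
  refine ⟨hmem, fun d i j₀ => ?_⟩
  by_cases hd : d ∈ β.monos
  · rw [hmem ⟨d, hd⟩, Finset.sum_eq_single ⟨d, hd⟩] <;> simp +contextual
  · exact hadd d hd i j₀

theorem basisCoords_sum_monomial (h : IsCoeffSystem γ) (w : β.monos → A) :
    basisCoords γ (∑ j : β.monos, monomial (j : Fin r →₀ ℕ) (w j)) = w := by
  simp only [map_sum, basisCoords_monomial, h.apply_coe]
  exact (pi_eq_sum_univ' w).symm

theorem basisCoords_X_mul (h : IsCoeffSystem γ) (i : Fin r) (f : MvPolynomial (Fin r) A) :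
    basisCoords γ (X i * f) =
      ∑ j : β.monos, basisCoords γ f j • γ ((j : Fin r →₀ ℕ) + Finsupp.single i 1) := by
  induction f using MvPolynomial.induction_on' with
  | monomial d a =>
    rw [X, monomial_mul, one_mul, basisCoords_monomial, basisCoords_monomial, add_comm]
    funext l
    simp only [Pi.smul_apply, smul_eq_mul, Finset.sum_apply, h.apply_add_single d, Finset.mul_sum,
      mul_assoc]
  | add p q hp hq => simp only [mul_add, map_add, hp, hq, Pi.add_apply, add_smul,
      Finset.sum_add_distrib]

theorem basisCoords_mul_eq_zero (h : IsCoeffSystem γ) (p : MvPolynomial (Fin r) A)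
    {q : MvPolynomial (Fin r) A} (hq : basisCoords γ q = 0) : basisCoords γ (p * q) = 0 := by
  induction p using MvPolynomial.induction_on with
  | C a => rw [← smul_eq_C_mul, map_smul, hq, smul_zero]
  | add p p' hp hp' => rw [add_mul, map_add, hp, hp', add_zero]
  | mul_X p i hp =>
    rw [mul_comm p, mul_assoc, h.basisCoords_X_mul, hp]
    simp only [Pi.zero_apply, zero_smul, Finset.sum_const_zero]

theorem basisCoords_eq_zero_of_mem (h : IsCoeffSystem γ) {f : MvPolynomial (Fin r) A}
    (hf : f ∈ coeffIdeal γ) : basisCoords γ f = 0 := by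
  induction hf using Submodule.span_induction with
  | mem f hf =>
    obtain ⟨d, rfl⟩ := hf
    rw [map_sub, h.basisCoords_sum_monomial, basisCoords_monomial, one_smul, sub_self]
  | zero => exact map_zero _
  | add p q _ _ hp hq => rw [map_add, hp, hq, add_zero]
  | smul p q _ hq => exact h.basisCoords_mul_eq_zero p hq

end IsCoeffSystem

namespace Expands

variable {B : Type*} [CommRing B] [Algebra A B] {x : Fin r → B}

theorem aeval_eq (h : Expands γ x) (f : MvPolynomial (Fin r) A) :
    aeval x f = ∑ j : β.monos, basisCoords γ f j • monomialValue x (j : Fin r →₀ ℕ) := by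
  induction f using MvPolynomial.induction_on' with
  | monomial d a =>
    simp only [aeval_monomial_eq_smul, h d, basisCoords_monomial, Finset.smul_sum, Pi.smul_apply,
      smul_assoc]
  | add p q hp hq => simp only [map_add, hp, hq, Pi.add_apply, add_smul, Finset.sum_add_distrib]

theorem unique (h : Expands γ x) (h' : Expands γ' x)
    (hx : LinearIndependent A fun j : β.monos => monomialValue x (j : Fin r →₀ ℕ)) : γ = γ' :=
  funext fun d => Fintype.linearIndependent_iffₛ.1 hx _ _ ((h d).symm.trans (h' d)) |> funext

theorem isCoeffSystem (h : Expands γ x)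
    (hx : LinearIndependent A fun j : β.monos => monomialValue x (j : Fin r →₀ ℕ)) :
    IsCoeffSystem γ where
  apply_coe j := funext <| Fintype.linearIndependent_iffₛ.1 hx _ _ <| by
    rw [← h j]
    simp [Pi.single_apply]
  apply_add_single d i := by
    have hcoeff : ∑ j₀, γ (d + Finsupp.single i 1) j₀ • monomialValue x (j₀ : Fin r →₀ ℕ) =
        ∑ j₀, (∑ j : β.monos, γ d j * γ ((j : Fin r →₀ ℕ) + Finsupp.single i 1) j₀) •
          monomialValue x (j₀ : Fin r →₀ ℕ) := by
      rw [← h, monomialValue_add_single, h d, Finset.mul_sum]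
      simp only [mul_smul_comm, ← monomialValue_add_single, h (_ + _), Finset.smul_sum,
        Finset.sum_smul, smul_smul]
      exact Finset.sum_comm
    exact Fintype.linearIndependent_iffₛ.1 hx _ _ hcoeff

theorem map {C : Type*} [CommRing C] [Algebra A C] (h : Expands γ x) (φ : B →ₐ[A] C) :
    Expands γ fun i => φ (x i) := fun d => by
  rw [← map_monomialValue φ, h d]
  simp only [map_sum, map_smul, map_monomialValue]

theorem aeval_eq_zero_iff (h : Expands γ x)
    (hx : LinearIndependent A fun j : β.monos => monomialValue x (j : Fin r →₀ ℕ))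
    {f : MvPolynomial (Fin r) A} : aeval x f = 0 ↔ basisCoords γ f = 0 := by
  rw [h.aeval_eq, funext_iff]
  exact ⟨Fintype.linearIndependent_iff.1 hx _, fun h => by simp [h]⟩

end Expands

theorem aeval_mk_X (J : Ideal (MvPolynomial (Fin r) A)) (f : MvPolynomial (Fin r) A) :
    aeval (fun i => Ideal.Quotient.mk J (X i)) f = Ideal.Quotient.mk J f :=
  DFunLike.congr_fun (aeval_unique (Ideal.Quotient.mkₐ A J)).symm f

theorem monomialValue_mk_X (J : Ideal (MvPolynomial (Fin r) A)) (d : Fin r →₀ ℕ) :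
    monomialValue (fun i => Ideal.Quotient.mk J (X i)) d = Ideal.Quotient.mk J (monomial d 1) := by
  rw [← aeval_mk_X, aeval_monomial_eq_smul, one_smul]

theorem expands_mk_X_iff {J : Ideal (MvPolynomial (Fin r) A)} :
    Expands γ (fun i => Ideal.Quotient.mk J (X i)) ↔ coeffIdeal γ ≤ J := by
  have hsum : ∀ d, ∑ j : β.monos, γ d j • Ideal.Quotient.mk J (monomial (j : Fin r →₀ ℕ) 1) =
      Ideal.Quotient.mk J (∑ j : β.monos, monomial (j : Fin r →₀ ℕ) (γ d j)) := fun d => by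
    simp only [map_sum, ← Ideal.Quotient.mkₐ_eq_mk A, ← map_smul, smul_eq_mul, mul_one]
  rw [coeffIdeal, Ideal.span_le]
  simp only [Expands, monomialValue_mk_X, hsum, Ideal.Quotient.eq]
  exact ⟨fun h f ⟨d, hd⟩ => hd ▸ h d, fun h d => h ⟨d, rfl⟩⟩

theorem coeffIdeal_map {B : Type*} [CommRing B] (γ : (Fin r →₀ ℕ) → β.monos → A) (φ : A →+* B) :
    (coeffIdeal γ).map (MvPolynomial.map φ) = coeffIdeal fun d j => φ (γ d j) := by
  have hset : {f | ∃ d : Fin r →₀ ℕ, f = monomial d 1 -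
      ∑ j : β.monos, monomial (j : Fin r →₀ ℕ) (γ d j)} =
      Set.range fun d => monomial d 1 - ∑ j : β.monos, monomial (j : Fin r →₀ ℕ) (γ d j) := by
    simp only [Set.range, eq_comm]
  rw [coeffIdeal, Ideal.map_span, hset, ← Set.range_comp, coeffIdeal]
  simp only [Set.range, Function.comp_def, map_sub, map_sum, map_monomial, map_one, eq_comm]

end Expansion

section HasBasis

variable {A : Type u} [CommRing A] {γ γ' : (Fin r →₀ ℕ) → β.monos → A}
  {J : Ideal (MvPolynomial (Fin r) A)}

theorem IsCoeffSystem.hasBasis (h : IsCoeffSystem γ) : HasBasis β (coeffIdeal γ) := by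
  have hexp : Expands γ fun i => Ideal.Quotient.mk (coeffIdeal γ) (X i) :=
    expands_mk_X_iff.2 le_rfl
  constructor
  · refine Fintype.linearIndependent_iff.2 fun w hw => congrFun ?_
    rw [← h.basisCoords_sum_monomial w]
    refine h.basisCoords_eq_zero_of_mem (Ideal.Quotient.eq_zero_iff_mem.1 ?_)
    simpa only [← Ideal.Quotient.mkₐ_eq_mk A, ← map_smul, smul_monomial, smul_eq_mul, mul_one,
      map_sum] using hw
  · refine Submodule.eq_top_iff'.2 fun y => ?_
    obtain ⟨f, rfl⟩ := Ideal.Quotient.mk_surjective y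
    rw [← aeval_mk_X, hexp.aeval_eq, Submodule.mem_span_range_iff_exists_fun]
    exact ⟨basisCoords γ f, by simp only [monomialValue_mk_X]⟩

namespace HasBasis

theorem linearIndependent_monomialValue (hJ : HasBasis β J) :
    LinearIndependent A fun j : β.monos =>
      monomialValue (fun i => Ideal.Quotient.mk J (X i)) (j : Fin r →₀ ℕ) := by
  simpa only [monomialValue_mk_X] using hJ.1

theorem exists_expands (hJ : HasBasis β J) :
    ∃ γ : (Fin r →₀ ℕ) → β.monos → A, Expands γ fun i => Ideal.Quotient.mk J (X i) := by
  choose γ hγ using fun d => (Submodule.mem_span_range_iff_exists_fun A).1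
    (hJ.2.ge (Submodule.mem_top (x := Ideal.Quotient.mk J (monomial d 1))))
  exact ⟨γ, fun d => by simp only [monomialValue_mk_X, hγ]⟩

theorem mem_iff (hJ : HasBasis β J) (h : coeffIdeal γ ≤ J) {f : MvPolynomial (Fin r) A} :
    f ∈ J ↔ basisCoords γ f = 0 := by
  rw [← (expands_mk_X_iff.2 h).aeval_eq_zero_iff hJ.linearIndependent_monomialValue, aeval_mk_X,
    Ideal.Quotient.eq_zero_iff_mem]

theorem isCoeffSystem (hJ : HasBasis β J) (h : coeffIdeal γ ≤ J) : IsCoeffSystem γ :=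
  (expands_mk_X_iff.2 h).isCoeffSystem hJ.linearIndependent_monomialValue

theorem coeffIdeal_eq (hJ : HasBasis β J) (h : coeffIdeal γ ≤ J) : coeffIdeal γ = J := by
  ext f
  rw [hJ.mem_iff h, (hJ.isCoeffSystem h).hasBasis.mem_iff le_rfl]

theorem coeff_unique (hJ : HasBasis β J) (h : coeffIdeal γ ≤ J) (h' : coeffIdeal γ' ≤ J) :
    γ = γ' :=
  (expands_mk_X_iff.2 h).unique (expands_mk_X_iff.2 h') hJ.linearIndependent_monomialValue

end HasBasis

end HasBasis

/-! ### The coordinate ring of the chart -/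

section CoordRing

variable (K : Type u) [Field K] {r : ℕ} (β : BasisSet r)

/-- The coefficients `c^d_j ∈ R` of the universal family, for all monomials `x^d`. -/
noncomputable def universalCoeff (d : Fin r →₀ ℕ) (j : β.monos) : CoordRing K β :=
  Ideal.Quotient.mk (relationIdeal K β) (coeffPoly K β d j)

theorem universalIdeal_eq : universalIdeal K β = coeffIdeal (universalCoeff K β) := rfl

theorem coeffPoly_coe (j : β.monos) : coeffPoly K β j = Pi.single j 1 := by
  funext l
  rw [Pi.single_apply, coeffPoly, dif_pos j.2]
  simp only [← Subtype.ext_iff, eq_comm]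

theorem isCoeffSystem_universalCoeff : IsCoeffSystem (universalCoeff K β) := by
  refine .of_notMem (fun j => funext fun l => ?_) fun d hd i j₀ => ?_
  · rw [universalCoeff, coeffPoly_coe, Pi.single_apply, Pi.single_apply,
      apply_ite (Ideal.Quotient.mk _), map_one, map_zero]
  · have hτ : tau K β d i j₀ ∈ relationIdeal K β := Ideal.subset_span ⟨d, hd, i, j₀, rfl⟩
    rw [universalCoeff, Ideal.Quotient.eq.2 hτ, map_sum]
    simp only [map_mul, universalCoeff]

variable {K β}

theorem universalCoeff_arrow (a : Arrow β) :
    universalCoeff K β a.tail ⟨a.head, a.head_mem⟩ = arrowFn K a := by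
  simp [universalCoeff, arrowFn, coeffPoly, a.tail_notMem]

theorem adjoin_range_arrowFn : Algebra.adjoin K (Set.range (arrowFn K (β := β))) = ⊤ := by
  have h := congrArg (Subalgebra.map (Ideal.Quotient.mkₐ K (relationIdeal K β)))
    (MvPolynomial.adjoin_range_X (R := K) (σ := Arrow β))
  rw [AlgHom.map_adjoin, ← Set.range_comp, Algebra.map_top,
    (AlgHom.range_eq_top _).2 (Ideal.Quotient.mkₐ_surjective K _)] at h
  exact h

/-- The coordinate ring is generated by the coefficients of the border monomials `x_i x^j`. -/
instance finiteType_coordRing : Algebra.FiniteType K (CoordRing K β) := by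
  let border : Set (CoordRing K β) := Set.range fun p : β.monos × Fin r × β.monos =>
    universalCoeff K β ((p.1 : Fin r →₀ ℕ) + Finsupp.single p.2.1 1) p.2.2
  have hcoe : ∀ j l : β.monos, universalCoeff K β j l ∈ Algebra.adjoin K border := fun j l => by
    rw [(isCoeffSystem_universalCoeff K β).apply_coe, Pi.single_apply]
    split_ifs
    exacts [one_mem _, zero_mem _]
  have hcoeff : ∀ d l, universalCoeff K β d l ∈ Algebra.adjoin K border := by
    intro d
    induction d using exponent_induction with
    | zero =>
      obtain ⟨j, hj⟩ := β.nonempty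
      exact hcoe ⟨0, β.mem_of_le hj zero_le⟩
    | add_single d i ih =>
      intro l
      rw [(isCoeffSystem_universalCoeff K β).apply_add_single]
      exact sum_mem fun j _ => mul_mem (ih j) (Algebra.subset_adjoin ⟨(j, i, l), rfl⟩)
  refine ⟨Subalgebra.fg_def.2 ⟨border, Set.finite_range _, top_le_iff.1 ?_⟩⟩
  rw [← adjoin_range_arrowFn, Algebra.adjoin_le_iff]
  rintro _ ⟨a, rfl⟩
  exact universalCoeff_arrow (K := K) a ▸ hcoeff _ _

section Lift

variable {A : Type*} [CommRing A] [Algebra K A] {γ : (Fin r →₀ ℕ) → β.monos → A}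

namespace IsCoeffSystem

theorem aeval_coeffPoly (hγ : IsCoeffSystem γ) (d : Fin r →₀ ℕ) (j : β.monos) :
    aeval (fun a : Arrow β => γ a.tail ⟨a.head, a.head_mem⟩) (coeffPoly K β d j) = γ d j := by
  by_cases hd : d ∈ β.monos
  · rw [hγ.apply_coe ⟨d, hd⟩, coeffPoly_coe K β ⟨d, hd⟩, Pi.single_apply, Pi.single_apply,
      apply_ite (aeval _), map_one, map_zero]
  · simp [coeffPoly, hd]

theorem aeval_eq_zero_of_mem_relationIdeal (hγ : IsCoeffSystem γ) (f : MvPolynomial (Arrow β) K)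
    (hf : f ∈ relationIdeal K β) :
    aeval (fun a : Arrow β => γ a.tail ⟨a.head, a.head_mem⟩) f = 0 := by
  have hle : relationIdeal K β ≤
      RingHom.ker (aeval (R := K) fun a : Arrow β => γ a.tail ⟨a.head, a.head_mem⟩) := by
    refine Ideal.span_le.2 ?_
    rintro _ ⟨d, -, i, j₀, rfl⟩
    simp only [tau, SetLike.mem_coe, RingHom.mem_ker, map_sub, map_sum, map_mul,
      hγ.aeval_coeffPoly, hγ.apply_add_single d, sub_self]
  exact hle hf

/-- The point of `U_β` given by a system of coefficients. -/
noncomputable def lift (hγ : IsCoeffSystem γ) : CoordRing K β →ₐ[K] A :=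
  Ideal.Quotient.liftₐ (relationIdeal K β) (aeval fun a : Arrow β => γ a.tail ⟨a.head, a.head_mem⟩)
    hγ.aeval_eq_zero_of_mem_relationIdeal

@[simp]
theorem lift_universalCoeff (hγ : IsCoeffSystem γ) (d : Fin r →₀ ℕ) (j : β.monos) :
    hγ.lift (universalCoeff K β d j) = γ d j :=
  hγ.aeval_coeffPoly d j

end IsCoeffSystem

theorem CoordRing.algHom_ext {φ ψ : CoordRing K β →ₐ[K] A}
    (h : ∀ d j, φ (universalCoeff K β d j) = ψ (universalCoeff K β d j)) : φ = ψ := by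
  refine Ideal.Quotient.algHom_ext _ (MvPolynomial.algHom_ext fun a => ?_)
  have := h a.tail ⟨a.head, a.head_mem⟩
  rwa [universalCoeff_arrow] at this

end Lift

variable (K β) in
theorem isUniversalFamily_universalIdeal :
    IsUniversalFamily K β (CoordRing K β) (universalIdeal K β) := by
  refine ⟨(isCoeffSystem_universalCoeff K β).hasBasis, fun A _ _ J hJ => ?_⟩
  obtain ⟨γ, hγ⟩ := hJ.exists_expands
  have hγJ : coeffIdeal γ ≤ J := expands_mk_X_iff.1 hγ
  have hlift := (hJ.isCoeffSystem hγJ).lift_universalCoeff (K := K)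
  refine ⟨(hJ.isCoeffSystem hγJ).lift, ?_, fun φ hφ => CoordRing.algHom_ext fun d j => ?_⟩
  · simp only [universalIdeal_eq, coeffIdeal_map, RingHom.coe_coe, hlift]
    exact hJ.coeffIdeal_eq hγJ
  · simp only [universalIdeal_eq, coeffIdeal_map, RingHom.coe_coe] at hφ
    rw [hlift]
    exact congrFun₂ (hJ.coeff_unique hφ.le hγJ) d j

theorem coeffIdeal_eq_monomialIdeal {γ : (Fin r →₀ ℕ) → β.monos → K} (hγ : IsCoeffSystem γ)
    (hzero : ∀ d ∉ β.monos, γ d = 0) : coeffIdeal γ = monomialIdeal K β := by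
  have hout : ∀ d ∉ β.monos, monomial d 1 - ∑ j : β.monos, monomial (j : Fin r →₀ ℕ) (γ d j) =
      monomial d (1 : K) := fun d hd => by
    simp [hzero d hd]
  refine le_antisymm (Ideal.span_le.2 ?_) (Ideal.span_le.2 ?_)
  · rintro _ ⟨d, rfl⟩
    by_cases hd : d ∈ β.monos
    · have hin : ∑ j : β.monos, monomial (j : Fin r →₀ ℕ) (γ d j) = monomial d 1 := by
        rw [hγ.apply_coe ⟨d, hd⟩, Finset.sum_eq_single ⟨d, hd⟩] <;> simp +contextual
      rw [hin, sub_self]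
      exact zero_mem _
    · exact Ideal.subset_span ⟨d, hd, hout d hd⟩
  · rintro _ ⟨d, hd, rfl⟩
    exact Ideal.subset_span ⟨d, (hout d hd).symm⟩

theorem originPoint_universalCoeff {d : Fin r →₀ ℕ} (hd : d ∉ β.monos) (j : β.monos) :
    originPoint K β (universalCoeff K β d j) = 0 :=
  aeval_zero_coeffPoly hd j

variable (K β) in
theorem universalIdeal_map_originPoint :
    (universalIdeal K β).map (MvPolynomial.map (originPoint K β : CoordRing K β →+* K)) =
      monomialIdeal K β := by
  rw [universalIdeal_eq, coeffIdeal_map]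
  exact coeffIdeal_eq_monomialIdeal ((isCoeffSystem_universalCoeff K β).map _)
    fun d hd => funext fun j => originPoint_universalCoeff hd j

end CoordRing

/-! ### First-order deformations of the monomial ideal -/

section Cotangent

variable {K : Type u} [Field K] {r : ℕ} {β : BasisSet r}

/-- The linear functional on the cotangent space of `I` given by an algebra map to the dual numbers
under which `I` maps to multiples of `ε`: a tangent vector along `I`. -/
noncomputable def tangentFunctional {R : Type*} [CommRing R] [Algebra K R] {I : Ideal R}
    (φ : R →ₐ[K] DualNumber K) (hφ : ∀ f ∈ I, (φ f).fst = 0) : Module.Dual K I.Cotangent :=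
  Ideal.Cotangent.lift
    (TrivSqZeroExt.sndHom K K ∘ₗ φ.toLinearMap ∘ₗ (I.restrictScalars K).subtype) fun x y => by
      change (φ (x * y : R)).snd = 0
      simp [hφ x x.2, hφ y y.2]

open scoped Classical in
/-- The first-order deformation of `I_β` in the direction dual to the translation class of `a`. -/
noncomputable def deformation (K : Type u) [Field K] (a : Arrow β) (d : Fin r →₀ ℕ)
    (j : β.monos) : DualNumber K :=
  if h : d ∈ β.monos then (Pi.single ⟨d, h⟩ 1 : β.monos → DualNumber K) j
  else if a.TransEquiv ⟨d, j, h, j.2⟩ then DualNumber.eps else 0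

theorem deformation_coe (a : Arrow β) (j : β.monos) : deformation K a j = Pi.single j 1 :=
  funext fun _ => dif_pos j.2

open scoped Classical in
theorem deformation_of_notMem (a : Arrow β) {d : Fin r →₀ ℕ} (hd : d ∉ β.monos) (j : β.monos) :
    deformation K a d j = if a.TransEquiv ⟨d, j, hd, j.2⟩ then DualNumber.eps else 0 :=
  dif_neg hd

theorem deformation_mul_deformation (a : Arrow β) {d e : Fin r →₀ ℕ} (hd : d ∉ β.monos)
    (he : e ∉ β.monos) (j l : β.monos) : deformation K a d j * deformation K a e l = 0 := by
  rw [deformation_of_notMem a hd, deformation_of_notMem a he]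
  split_ifs <;> simp [DualNumber.eps_mul_eps]

theorem deformation_mul_deformation_eq_ite (a : Arrow β) {d : Fin r →₀ ℕ} (hd : d ∉ β.monos)
    (e : Fin r →₀ ℕ) (j l : β.monos) : deformation K a d j * deformation K a e l =
      if e = (l : Fin r →₀ ℕ) then deformation K a d j else 0 := by
  by_cases he : e ∈ β.monos
  · simp [deformation_coe a ⟨e, he⟩, Pi.single_apply, Subtype.ext_iff, eq_comm]
  · rw [deformation_mul_deformation a hd he, if_neg fun h : e = l => he (h ▸ l.2)]

theorem deformation_add_single (a : Arrow β) {d : Fin r →₀ ℕ} {i : Fin r} (hd : d ∉ β.monos)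
    {j l : β.monos} (hjl : (j : Fin r →₀ ℕ) + Finsupp.single i 1 = (l : Fin r →₀ ℕ)) :
    deformation K a (d + Finsupp.single i 1) l = deformation K a d j := by
  classical
  have hd' : d + Finsupp.single i 1 ∉ β.monos := fun h => hd (β.mem_of_le h le_self_add)
  have hstep : Arrow.Step (⟨d, j, hd, j.2⟩ : Arrow β) ⟨d + Finsupp.single i 1, l, hd', l.2⟩ :=
    ⟨i, Or.inl ⟨rfl, hjl.symm⟩⟩
  rw [deformation_of_notMem a hd, deformation_of_notMem a hd']
  exact if_congr ⟨fun h => h.tail hstep.symm, fun h => h.tail hstep⟩ rfl rfl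

theorem isCoeffSystem_deformation {a : Arrow β} (ha : ¬ a.EquivZero) :
    IsCoeffSystem (deformation K a) := by
  refine .of_notMem (deformation_coe a) fun d hd i l => ?_
  simp only [deformation_mul_deformation_eq_ite a hd]
  by_cases hl : (l : Fin r →₀ ℕ) i = 0
  · have hd' : d + Finsupp.single i 1 ∉ β.monos := fun h => hd (β.mem_of_le h le_self_add)
    rw [deformation_of_notMem a hd', if_neg fun h => ha ⟨_, h, i, hl, d, hd, rfl⟩]
    refine (Finset.sum_eq_zero fun j _ => if_neg fun h => ?_).symm
    simp [← h] at hl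
  · have hle : Finsupp.single i 1 ≤ (l : Fin r →₀ ℕ) :=
      Finsupp.single_le_iff.2 (Nat.one_le_iff_ne_zero.2 hl)
    let j : β.monos := ⟨(l : Fin r →₀ ℕ) - Finsupp.single i 1, β.mem_of_le l.2 tsub_le_self⟩
    have hj : (j : Fin r →₀ ℕ) + Finsupp.single i 1 = (l : Fin r →₀ ℕ) := tsub_add_cancel_of_le hle
    rw [deformation_add_single a hd hj, Finset.sum_eq_single j, if_pos hj]
    · exact fun j' _ hj' => if_neg fun h => hj' (Subtype.ext (add_right_cancel (h.trans hj.symm)))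
    · exact fun h => absurd (Finset.mem_univ j) h

theorem fst_lift_deformation {a : Arrow β} (ha : ¬ a.EquivZero) (f : CoordRing K β) :
    ((isCoeffSystem_deformation ha).lift (K := K) f).fst = originPoint K β f := by
  have hcomp : (TrivSqZeroExt.fstHom K K K).comp ((isCoeffSystem_deformation ha).lift (K := K)) =
      originPoint K β := by
    refine CoordRing.algHom_ext fun d j => ?_
    rw [AlgHom.comp_apply, IsCoeffSystem.lift_universalCoeff, TrivSqZeroExt.fstHom_apply]
    by_cases hd : d ∈ β.monos
    · rw [deformation_coe a ⟨d, hd⟩, (isCoeffSystem_universalCoeff K β).apply_coe ⟨d, hd⟩,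
        Pi.single_apply, Pi.single_apply]
      split_ifs <;> simp
    · rw [originPoint_universalCoeff hd, deformation_of_notMem a hd]
      split_ifs <;> simp
  exact DFunLike.congr_fun hcomp f

theorem linearIndependent_arrowClass {S : Set (Arrow β)} (h0 : ∀ a ∈ S, ¬ a.EquivZero)
    (hS : ∀ a ∈ S, ∀ b ∈ S, a.TransEquiv b → a = b) :
    LinearIndependent K (fun a : S => arrowClass K (a : Arrow β)) := by
  classical
  let tangent (a : S) : Module.Dual K (originIdeal K β).Cotangent :=
    tangentFunctional ((isCoeffSystem_deformation (h0 a a.2)).lift (K := K))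
      fun f hf => (fst_lift_deformation (h0 a a.2) f).trans hf
  have htangent : ∀ a b : S, tangent a (arrowClass K (b : Arrow β)) =
      (if (a : Arrow β).TransEquiv b then DualNumber.eps else 0 : DualNumber K).snd := fun a b => by
    rw [← deformation_of_notMem (K := K) (a : Arrow β) b.1.tail_notMem ⟨b.1.head, b.1.head_mem⟩,
      ← (isCoeffSystem_deformation (h0 a a.2)).lift_universalCoeff (K := K), universalCoeff_arrow]
    rfl
  refine .of_pairwise_dual_eq_zero_one _ tangent (fun a b hab => ?_) fun a => ?_
  · exact (htangent a b).trans <| by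
      rw [if_neg fun h => hab (Subtype.ext (hS a a.2 b b.2 h)), TrivSqZeroExt.snd_zero]
  · rw [htangent, if_pos .refl, DualNumber.snd_eps]

theorem BasisSet.IsStandardBunch.linearIndependent {S : Set (Arrow β)} (h : β.IsStandardBunch S) :
    LinearIndependent K (fun a : S => arrowClass K (a : Arrow β)) :=
  linearIndependent_arrowClass (fun _ ha => h.not_equivZero ha)
    fun _ ha _ hb hab => h.eq_of_transEquiv ha hb hab

end Cotangent

/-! ### Regular local rings are domains -/

section CotangentSpace

open IsLocalRing

variable {R : Type*} [CommRing R] [IsLocalRing R]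

theorem isLocalRing_quotient_span_singleton {x : R} (hx : x ∈ maximalIdeal R) :
    IsLocalRing (R ⧸ Ideal.span {x}) :=
  have : Nontrivial (R ⧸ Ideal.span {x}) := Ideal.Quotient.nontrivial_iff.2 fun h =>
    (mem_maximalIdeal x).1 hx (Ideal.span_singleton_eq_top.1 h)
  .of_surjective' (Ideal.Quotient.mk _) Ideal.Quotient.mk_surjective

variable [IsNoetherianRing R]

theorem exists_span_eq_top_of_ne_zero (k : Type*) {V : Type*} [Field k] [AddCommGroup V]
    [Module k V] [FiniteDimensional k V] {v : V} (hv : v ≠ 0) :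
    ∃ s : Set V, s.Finite ∧ v ∈ s ∧ Submodule.span k s = ⊤ ∧ s.ncard = Module.finrank k V := by
  have hli : LinearIndepOn k id {v} := LinearIndepOn.singleton (R := k) hv
  let b := Module.Basis.extend hli
  refine ⟨_, ?_, hli.subset_extend (Set.subset_univ _) rfl, ?_, ?_⟩
  · exact Set.finite_coe_iff.1 (Module.Finite.finite_basis b)
  · rw [← b.span_eq, Module.Basis.range_extend]
  · rw [Module.finrank_eq_nat_card_basis b, Nat.card_coe_set_eq]

theorem exists_mem_span_eq_maximalIdeal {x : R} (hx : x ∈ maximalIdeal R)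
    (hx2 : x ∉ maximalIdeal R ^ 2) : ∃ s : Set R, s.Finite ∧ x ∈ s ∧
      Ideal.span s = maximalIdeal R ∧ s.ncard ≤ (maximalIdeal R).spanFinrank := by
  classical
  have hv : (maximalIdeal R).toCotangent ⟨x, hx⟩ ≠ 0 := by
    rwa [Ne, Ideal.toCotangent_eq_zero]
  obtain ⟨t, ht, hvt, hspan, hcard⟩ := exists_span_eq_top_of_ne_zero (ResidueField R) hv
  let lift := Function.update (Function.surjInv (maximalIdeal R).toCotangent_surjective)
    ((maximalIdeal R).toCotangent ⟨x, hx⟩) ⟨x, hx⟩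
  have hlift : ∀ v, (maximalIdeal R).toCotangent (lift v) = v := fun v => by
    obtain rfl | hne := eq_or_ne v ((maximalIdeal R).toCotangent ⟨x, hx⟩)
    · simp only [lift, Function.update_self]
    · simp only [lift, Function.update_of_ne hne]
      exact Function.surjInv_eq _ v
  have htop : Submodule.span R (lift '' t) = ⊤ := by
    rw [← CotangentSpace.span_image_eq_top_iff, Set.image_image]
    simpa only [hlift, Set.image_id'] using hspan
  refine ⟨_, (ht.image lift).image (↑), ⟨_, ⟨_, hvt, rfl⟩, by simp [lift]⟩, ?_, ?_⟩
  · have h := congrArg (Submodule.map (maximalIdeal R).subtype) htop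
    rwa [Submodule.map_span, Submodule.map_top, Submodule.range_subtype] at h
  · rw [spanFinrank_maximalIdeal_eq_finrank_cotangentSpace, ← hcard]
    exact (Set.ncard_image_le (ht.image lift)).trans (Set.ncard_image_le ht)

theorem spanFinrank_maximalIdeal_quotient_lt {x : R} (hx : x ∈ maximalIdeal R)
    (hx2 : x ∉ maximalIdeal R ^ 2) [IsLocalRing (R ⧸ Ideal.span {x})] :
    (maximalIdeal (R ⧸ Ideal.span {x})).spanFinrank < (maximalIdeal R).spanFinrank := by
  obtain ⟨s, hs, hxs, hspan, hcard⟩ := exists_mem_span_eq_maximalIdeal hx hx2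
  let π := Ideal.Quotient.mk (Ideal.span {x})
  have hmap : maximalIdeal (R ⧸ Ideal.span {x}) = Ideal.span (π '' s \ {0}) := by
    rw [← map_maximalIdeal_of_surjective π Ideal.Quotient.mk_surjective, ← hspan, Ideal.map_span,
      Ideal.span_sdiff_singleton_zero]
  have hsub : π '' s \ {0} ⊆ π '' (s \ {x}) := by
    rintro _ ⟨⟨y, hy, rfl⟩, hy0⟩
    refine ⟨y, ⟨hy, ?_⟩, rfl⟩
    rintro rfl
    exact hy0 (Ideal.Quotient.eq_zero_iff_mem.2 (Ideal.mem_span_singleton_self y))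
  calc (maximalIdeal (R ⧸ Ideal.span {x})).spanFinrank
    _ ≤ (π '' s \ {0}).ncard := by
      rw [hmap]
      exact Submodule.spanFinrank_span_le_ncard_of_finite (hs.image π).sdiff
    _ ≤ (π '' (s \ {x})).ncard := Set.ncard_le_ncard hsub (hs.sdiff.image π)
    _ ≤ (s \ {x}).ncard := Set.ncard_image_le hs.sdiff
    _ < s.ncard := Set.ncard_sdiff_singleton_lt_of_mem hxs hs
    _ ≤ (maximalIdeal R).spanFinrank := hcard

/-- Prime avoidance, which allows the one non-prime ideal `m²`. -/
theorem exists_mem_maximalIdeal_notMem_sq_notMem_minimalPrimes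
    (hR : maximalIdeal R ∉ minimalPrimes R) :
    ∃ x ∈ maximalIdeal R, x ∉ maximalIdeal R ^ 2 ∧ ∀ p ∈ minimalPrimes R, x ∉ p := by
  by_contra! hcon
  have hcover : (maximalIdeal R : Set R) ⊆
      ⋃ p ∈ insert (maximalIdeal R ^ 2) (minimalPrimes R), (id p : Ideal R) := by
    intro x hx
    simp only [Set.biUnion_insert, Set.mem_union, Set.mem_iUnion₂, id, SetLike.mem_coe]
    exact or_iff_not_imp_left.2 fun hx2 => (hcon x hx hx2).imp fun p hp => ⟨hp.1, hp.2⟩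
  obtain ⟨p, rfl | hp, hle⟩ := (Ideal.subset_union_prime_finite (f := id)
    ((minimalPrimes.finite_of_isNoetherianRing R).insert _) (maximalIdeal R ^ 2)
    (maximalIdeal R ^ 2) fun p hp hp2 _ =>
      Ideal.IsMinimalPrime.isPrime (hp.resolve_left hp2)).1 hcover
  · have hbot : maximalIdeal R = ⊥ := by
      refine Submodule.eq_bot_of_le_smul_of_le_jacobson_bot _ _
        (maximalIdeal R).fg_of_isNoetherianRing ?_ (jacobson_eq_maximalIdeal ⊥ bot_ne_top).ge
      rwa [id, pow_two] at hle
    exact hR ⟨⟨inferInstance, bot_le⟩, fun q _ _ => hbot ▸ bot_le⟩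
  · have := Ideal.IsMinimalPrime.isPrime hp
    exact hR ((le_maximalIdeal this.ne_top).antisymm hle ▸ hp)

/-- A minimal prime `p ⊆ (x)` not containing `x` satisfies `p = x p`, so it vanishes by Nakayama. -/
theorem isDomain_of_isPrime_span_singleton {x : R} (hx : x ∈ maximalIdeal R)
    (hprime : (Ideal.span {x}).IsPrime) (hmin : ∀ p ∈ minimalPrimes R, x ∉ p) : IsDomain R := by
  obtain ⟨p, hp, hle⟩ := Ideal.exists_minimalPrimes_le (bot_le : ⊥ ≤ Ideal.span {x})
  have hpp := Ideal.IsMinimalPrime.isPrime hp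
  have hbot : p = ⊥ := by
    refine Submodule.eq_bot_of_le_smul_of_le_jacobson_bot (maximalIdeal R) p
      p.fg_of_isNoetherianRing (fun y hy => ?_) (jacobson_eq_maximalIdeal ⊥ bot_ne_top).ge
    obtain ⟨z, rfl⟩ := Ideal.mem_span_singleton.1 (hle hy)
    exact Ideal.mul_mem_mul hx ((hpp.mem_or_mem hy).resolve_left (hmin p hp))
  rw [hbot] at hpp
  exact IsDomain.of_bot_isPrime R

end CotangentSpace

section RegularLocalRing

open IsLocalRing

theorem isRegularLocalRing_quotient_span_singleton {R : Type*} [CommRing R]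
    [hR : IsRegularLocalRing R] {x : R}
    (hx : x ∈ maximalIdeal R) (hx2 : x ∉ maximalIdeal R ^ 2) :
    IsRegularLocalRing (R ⧸ Ideal.span {x}) := by
  have := isLocalRing_quotient_span_singleton hx
  refine .of_spanFinrank_maximalIdeal_le _ (ENat.WithBot.add_le_add_one_right_iff.1 ?_)
  calc ((maximalIdeal (R ⧸ Ideal.span {x})).spanFinrank + 1 : WithBot ℕ∞)
    _ ≤ (maximalIdeal R).spanFinrank := by
      exact_mod_cast spanFinrank_maximalIdeal_quotient_lt hx hx2
    _ = (maximalIdeal R).height := by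
      rw [hR.spanFinrank_maximalIdeal, maximalIdeal_height_eq_ringKrullDim]
    _ ≤ ringKrullDim (R ⧸ Ideal.span {x}) + 1 := Ideal.height_le_ringKrullDim_quotient_add_one hx

/-- Induction on the embedding dimension, cutting by `x` outside `m²` and all minimal primes. -/
theorem isDomain_of_isRegularLocalRing (R : Type*) [CommRing R] [hR : IsRegularLocalRing R] :
    IsDomain R := by
  induction h : (maximalIdeal R).spanFinrank using Nat.strong_induction_on generalizing R with
  | _ n ih =>
  by_cases hmin : maximalIdeal R ∈ minimalPrimes R
  · have hheight : (maximalIdeal R).height = 0 := Ideal.height_eq_zero_iff.2 hmin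
    have hzero : (maximalIdeal R).spanFinrank = 0 := by
      have := hR.spanFinrank_maximalIdeal
      rw [← maximalIdeal_height_eq_ringKrullDim, hheight] at this
      exact_mod_cast this
    have hbot := (Submodule.spanFinrank_eq_zero_iff_eq_bot
      (maximalIdeal R).fg_of_isNoetherianRing).1 hzero
    exact (isField_iff_maximalIdeal_eq.2 hbot).isDomain
  · obtain ⟨x, hx, hx2, hxmin⟩ := exists_mem_maximalIdeal_notMem_sq_notMem_minimalPrimes hmin
    have hreg := isRegularLocalRing_quotient_span_singleton hx hx2
    have hdom := ih _ (h ▸ spanFinrank_maximalIdeal_quotient_lt hx hx2) (R ⧸ Ideal.span {x}) rfl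
    exact isDomain_of_isPrime_span_singleton hx ((Ideal.Quotient.isDomain_iff_prime _).1 hdom) hxmin

end RegularLocalRing

/-! ### Heights of maximal ideals -/

theorem height_eq_of_isMaximal_mvPolynomial {K : Type*} [Field K] (s : ℕ)
    (M : Ideal (MvPolynomial (Fin s) K)) [hM : M.IsMaximal] : M.height = s := by
  induction s with
  | zero =>
    have h := Ideal.height_le_ringKrullDim_of_ne_top hM.ne_top
    rw [MvPolynomial.ringKrullDim_of_isNoetherianRing, ringKrullDim_eq_zero_of_field] at h
    simpa using h
  | succ s ih =>
    let e := (finSuccEquiv K s).toRingEquiv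
    let N : Ideal (Polynomial (MvPolynomial (Fin s) K)) := M.map e
    have hN : N.IsMaximal := Ideal.map_isMaximal_of_equiv e
    have hu : (N.under (MvPolynomial (Fin s) K)).IsMaximal :=
      Polynomial.isMaximal_comap_C_of_isJacobsonRing N
    have : N.LiesOver (N.under (MvPolynomial (Fin s) K)) := ⟨rfl⟩
    rw [← e.height_map M, Polynomial.height_eq_height_add_one (N.under _) N, ih, Nat.cast_succ]

theorem height_under_eq_height_of_isIntegral {A D : Type*} [CommRing A] [IsDomain A]
    [IsIntegrallyClosed A] [IsNoetherianRing A] [CommRing D] [IsDomain D] [IsNoetherianRing D]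
    [Algebra A D] [Algebra.IsIntegral A D] [FaithfulSMul A D] (M : Ideal D) [M.IsPrime] :
    (M.under A).height = M.height := by
  refine le_antisymm ?_ ?_
  · rw [Ideal.height_eq_height_add_of_liesOver_of_hasGoingDown (M.under A) M]
    exact le_self_add
  · have hmono : StrictMono (PrimeSpectrum.comap (algebraMap A D)) :=
      fun p q hpq => Ideal.IsIntegral.comap_lt_comap hpq
    have h := Order.height_le_height_apply_of_strictMono _ hmono ⟨M, inferInstance⟩
    rwa [← PrimeSpectrum.height_eq_orderHeight, ← PrimeSpectrum.height_eq_orderHeight] at h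

theorem height_eq_of_isMaximal_of_trdeg_eq {K D : Type*} [Field K] [CommRing D] [IsDomain D]
    [Algebra K D] [Algebra.FiniteType K D] {n : ℕ} (hD : Algebra.trdeg K D = n) (M : Ideal D)
    [M.IsMaximal] : M.height = n := by
  obtain ⟨s, g, hg, hint⟩ := exists_integral_inj_algHom_of_fg K D
  algebraize [g.toRingHom]
  have : IsNoetherianRing D := Algebra.FiniteType.isNoetherianRing K D
  have : IsScalarTower K (MvPolynomial (Fin s) K) D := IsScalarTower.of_algHom g
  have : Algebra.IsIntegral (MvPolynomial (Fin s) K) D := ⟨hint⟩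
  have : FaithfulSMul (MvPolynomial (Fin s) K) D :=
    (faithfulSMul_iff_algebraMap_injective _ _).2 hg
  have hsn : s = n := by
    have h := lift_trdeg_add_eq K (MvPolynomial (Fin s) K) D
    rw [trdeg_eq_zero (R := MvPolynomial (Fin s) K), MvPolynomial.trdeg_of_isDomain, hD] at h
    simpa using h
  have := Ideal.isMaximal_comap_of_isIntegral_of_isMaximal (R := MvPolynomial (Fin s) K) M
  rw [← height_under_eq_height_of_isIntegral (A := MvPolynomial (Fin s) K) M, ← hsn]
  exact height_eq_of_isMaximal_mvPolynomial s _

section Quotient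

variable {R : Type*} [CommRing R] {P M : Ideal R} [hM : M.IsPrime]

theorem height_map_mk_le_height (hPM : P ≤ M) :
    (M.map (Ideal.Quotient.mk P)).height ≤ M.height := by
  have : (M.map (Ideal.Quotient.mk P)).IsPrime :=
    Ideal.map_isPrime_of_surjective Ideal.Quotient.mk_surjective (by rwa [Ideal.mk_ker])
  have h := Order.height_le_height_apply_of_strictMono _
    (RingHom.strictMono_comap_of_surjective (Ideal.Quotient.mk_surjective (I := P)))
    ⟨M.map (Ideal.Quotient.mk P), this⟩
  rwa [← PrimeSpectrum.height_eq_orderHeight, ← PrimeSpectrum.height_eq_orderHeight,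
    PrimeSpectrum.comap_asIdeal, Ideal.comap_map_of_surjective' _ Ideal.Quotient.mk_surjective,
    Ideal.mk_ker, sup_eq_left.2 hPM] at h

theorem height_le_height_map_mk (hP : ∀ p : Ideal R, p.IsPrime → p ≤ M → P ≤ p) :
    M.height ≤ (M.map (Ideal.Quotient.mk P)).height := by
  have hprime : (M.map (Ideal.Quotient.mk P)).IsPrime :=
    Ideal.map_isPrime_of_surjective Ideal.Quotient.mk_surjective
      (by rw [Ideal.mk_ker]; exact hP M hM le_rfl)
  let e := P.primeSpectrumQuotientOrderIsoZeroLocus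
  let quot (p : Set.Iic (⟨M, hM⟩ : PrimeSpectrum R)) : PrimeSpectrum (R ⧸ P) :=
    e.symm ⟨p, hP p.1.asIdeal p.1.isPrime p.2⟩
  have hquot_mono : StrictMono quot := fun p q hpq => e.symm.strictMono hpq
  have hquot_le (p) : quot p ≤ ⟨M.map (Ideal.Quotient.mk P), hprime⟩ :=
    Ideal.map_mono p.2
  have h := Order.krullDim_le_of_strictMono
    (fun p => (⟨quot p, hquot_le p⟩ : Set.Iic (⟨_, hprime⟩ : PrimeSpectrum (R ⧸ P)))) hquot_mono
  rw [← Order.height_eq_krullDim_Iic, ← Order.height_eq_krullDim_Iic,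
    ← PrimeSpectrum.height_eq_orderHeight, ← PrimeSpectrum.height_eq_orderHeight] at h
  exact_mod_cast h

end Quotient

/-! ### The cotangent space at a rational point -/

section RationalPoint

open IsLocalRing IsLocalization

variable {K R : Type*} [Field K] [CommRing R] [Algebra K R] {M : Ideal R}

theorem algebraMap_quotient_ker_surjective (φ : R →ₐ[K] K) :
    Function.Surjective (algebraMap K (R ⧸ RingHom.ker φ)) := by
  intro f
  obtain ⟨f, rfl⟩ := Ideal.Quotient.mk_surjective f
  refine ⟨φ f, Ideal.Quotient.eq.2 ?_⟩
  rw [RingHom.mem_ker, map_sub, AlgHom.commutes]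
  exact sub_self _

theorem finite_cotangent [IsNoetherianRing R] (hM : Function.Surjective (algebraMap K (R ⧸ M))) :
    Module.Finite K M.Cotangent := by
  have : Module.Finite K (R ⧸ M) := Module.Finite.of_surjective (Algebra.linearMap K (R ⧸ M)) hM
  have : IsScalarTower K (R ⧸ M) M.Cotangent := ⟨fun c f x => by
    obtain ⟨f, rfl⟩ := Ideal.Quotient.mk_surjective f
    exact smul_assoc c f x⟩
  have : Module.Finite R M.Cotangent := .of_surjective M.toCotangent M.toCotangent_surjective
  have : Module.Finite (R ⧸ M) M.Cotangent := .of_restrictScalars_finite R (R ⧸ M) M.Cotangent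
  exact Module.Finite.trans (R ⧸ M) M.Cotangent

variable [M.IsMaximal]

variable (K M) in
theorem nonempty_cotangent_equiv_localization :
    Nonempty (M.Cotangent ≃ₗ[K] (maximalIdeal (Localization.AtPrime M)).Cotangent) := by
  let φ := M.mapCotangent (maximalIdeal (Localization.AtPrime M))
    (IsScalarTower.toAlgHom K R (Localization.AtPrime M))
    fun x hx => (AtPrime.to_map_mem_maximal_iff _ M x).2 hx
  suffices Function.Bijective φ from ⟨.ofBijective φ this⟩
  constructor
  · refine (injective_iff_map_eq_zero _).2 fun x hx => ?_
    obtain ⟨x, rfl⟩ := M.toCotangent_surjective x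
    replace hx := (Ideal.toCotangent_eq_zero _ _).1 hx
    rwa [Ideal.toCotangent_eq_zero,
      ← AtPrime.under_maximalIdeal_pow M (Localization.AtPrime M), Ideal.mem_under]
  · intro y
    obtain ⟨y, rfl⟩ := Ideal.toCotangent_surjective _ y
    obtain ⟨x, hx⟩ := (AtPrime.equivQuotMaximalIdealPow M (Localization.AtPrime M) 2).surjective
      (Ideal.Quotient.mk _ y)
    obtain ⟨x, rfl⟩ := Ideal.Quotient.mk_surjective x
    rw [AtPrime.equivQuotMaximalIdealPow_apply_mk, Ideal.Quotient.eq] at hx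
    have hxM : x ∈ M := by
      rw [← AtPrime.to_map_mem_maximal_iff (Localization.AtPrime M) M]
      exact (Submodule.sub_mem_iff_left _ y.2).1 (Ideal.pow_le_self two_ne_zero hx)
    exact ⟨M.toCotangent ⟨x, hxM⟩, (Ideal.toCotangent_eq _).2 hx⟩

theorem finrank_cotangentSpace_localization (hM : Function.Surjective (algebraMap K (R ⧸ M))) :
    Module.finrank (ResidueField (Localization.AtPrime M))
      (CotangentSpace (Localization.AtPrime M)) = Module.finrank K M.Cotangent := by
  have hres : Function.Bijective (algebraMap K M.ResidueField) := by
    refine ⟨(algebraMap K _).injective, ?_⟩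
    rw [IsScalarTower.algebraMap_eq K (R ⧸ M) M.ResidueField]
    exact M.bijective_algebraMap_quotient_residueField.surjective.comp hM
  obtain ⟨e⟩ := nonempty_cotangent_equiv_localization K M
  have hsmul (c : K) (x : M.Cotangent) : e (c • x) = algebraMap K M.ResidueField c • e x :=
    (e.map_smul c x).trans <| (algebraMap_smul (Localization.AtPrime M) c (e x)).symm.trans
      (algebraMap_smul M.ResidueField (algebraMap K (Localization.AtPrime M) c)
        (e x : CotangentSpace (Localization.AtPrime M))).symm
  exact congrArg Cardinal.toNat (rank_eq_of_equiv_equiv _ e.toAddEquiv hres hsmul).symm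

theorem isRegularLocalRing_localization_iff [IsNoetherianRing R]
    (hM : Function.Surjective (algebraMap K (R ⧸ M))) :
    IsRegularLocalRing (Localization.AtPrime M) ↔
      (Module.finrank K M.Cotangent : ℕ∞) ≤ M.height := by
  have hdim := AtPrime.ringKrullDim_eq_height M (Localization.AtPrime M)
  have hspan : (maximalIdeal (Localization.AtPrime M)).spanFinrank =
      Module.finrank K M.Cotangent := by
    rw [spanFinrank_maximalIdeal_eq_finrank_cotangentSpace, finrank_cotangentSpace_localization hM]
  refine ⟨fun h => ?_, fun h => .of_spanFinrank_maximalIdeal_le _ ?_⟩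
  · have := h.spanFinrank_maximalIdeal
    rw [hdim, hspan] at this
    exact_mod_cast this.le
  · rw [hdim, hspan]
    exact_mod_cast h

end RationalPoint

/-! ### Tuples of points indexed by the basis -/

section ValueDet

variable {r : ℕ} {β : BasisSet r} {A : Type*} [CommRing A]

/-- For points indexed by `β`, with `x i p` the `i`-th coordinate of the `p`-th point, the
determinant of the values of the monomials of `β`. If it is invertible, then the ideal of the
points has the basis `β`. -/
noncomputable def valueDet (x : Fin r → β.monos → A) : A :=
  (Matrix.of fun j p : β.monos => monomialValue x (j : Fin r →₀ ℕ) p).det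

theorem monomialValue_apply {ι : Type*} (x : Fin r → ι → A) (d : Fin r →₀ ℕ) (p : ι) :
    monomialValue x d p = monomialValue (fun i => x i p) d :=
  map_monomialValue (Pi.evalMonoidHom (fun _ : ι => A) p) x d

theorem monomialValue_comp {ι A' : Type*} [CommRing A'] (φ : A →+* A') (x : Fin r → ι → A)
    (d : Fin r →₀ ℕ) (p : ι) :
    monomialValue (fun i p => φ (x i p)) d p = φ (monomialValue x d p) := by
  simp only [monomialValue_apply, map_monomialValue]

theorem map_valueDet {A' : Type*} [CommRing A'] (φ : A →+* A') (x : Fin r → β.monos → A) :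
    φ (valueDet x) = valueDet fun i p => φ (x i p) := by
  rw [valueDet, φ.map_det, valueDet]
  congr 1
  ext j p
  exact (monomialValue_comp φ x _ p).symm

theorem linearIndependent_of_valueDet_ne_zero [IsDomain A] {x : Fin r → β.monos → A}
    (hx : valueDet x ≠ 0) :
    LinearIndependent A fun j : β.monos => monomialValue x (j : Fin r →₀ ℕ) :=
  Matrix.linearIndependent_rows_of_det_ne_zero hx

theorem exists_expands_of_isUnit_valueDet {x : Fin r → β.monos → A} (hx : IsUnit (valueDet x)) :
    ∃ γ : (Fin r →₀ ℕ) → β.monos → A, Expands γ x := by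
  choose γ hγ using fun d => Matrix.vecMul_surjective_iff_isUnit.2
    ((Matrix.isUnit_iff_isUnit_det _).2 hx) (monomialValue x d)
  exact ⟨γ, fun d => (hγ d).symm.trans (Matrix.vecMul_eq_sum _ _)⟩

theorem Expands.map_pi {ι A' : Type*} [CommRing A'] {γ : (Fin r →₀ ℕ) → β.monos → A}
    {x : Fin r → ι → A} (h : Expands γ x) (φ : A →+* A') :
    Expands (fun d j => φ (γ d j)) fun i p => φ (x i p) := fun d => by
  funext p
  simp [monomialValue_comp, h d]

end ValueDet

/-! ### The discriminant -/

section Discriminant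

theorem isReduced_of_discr_ne_zero {L B ι : Type*} [Field L] [CommRing B] [Algebra L B] [Fintype ι]
    [DecidableEq ι] (b : Module.Basis ι L B) (hb : Algebra.discr L b ≠ 0) : IsReduced B := by
  refine ⟨fun x hx => ?_⟩
  rw [Algebra.discr_def, Algebra.traceMatrix_of_basis,
    ← LinearMap.BilinForm.nondegenerate_iff_det_ne_zero] at hb
  refine hb.1 x fun y => ?_
  have hnil : IsNilpotent (x * y) := (Commute.all x y).isNilpotent_mul_right hx
  exact (Algebra.isNilpotent_trace_of_isNilpotent hnil).eq_zero

theorem trace_pi {A ι : Type*} [CommRing A] [Fintype ι] (f : ι → A) :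
    Algebra.trace A (ι → A) f = ∑ p, f p := by
  classical
  rw [Algebra.trace_eq_matrix_trace (Pi.basisFun A ι)]
  simp [Matrix.trace, Algebra.leftMulMatrix_eq_repr_mul]

theorem discr_pi {A ι : Type*} [CommRing A] [Fintype ι] [DecidableEq ι] (b : ι → ι → A) :
    Algebra.discr A b = (Matrix.of b).det ^ 2 := by
  have h : Algebra.traceMatrix A b = Matrix.of b * (Matrix.of b).transpose := by
    ext j j'
    simp [Algebra.traceMatrix_apply, Algebra.traceForm_apply, trace_pi, Matrix.mul_apply]
  rw [Algebra.discr_def, h, Matrix.det_mul, Matrix.det_transpose, sq]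

theorem nonempty_algEquiv_pi_of_isReduced {L B ι : Type*} [Field L] [IsAlgClosed L] [CommRing B]
    [Algebra L B] [IsReduced B] [Finite ι] (b : Module.Basis ι L B) :
    Nonempty (B ≃ₐ[L] (ι → L)) := by
  have := Module.Finite.of_basis b
  have : IsArtinianRing B := IsArtinianRing.of_finite L B
  let := Fintype.ofFinite ι
  have hbij (m : MaximalSpectrum B) : Function.Bijective (algebraMap L (B ⧸ m.asIdeal)) :=
    IsAlgClosed.algebraMap_bijective_of_isIntegral
  let e : B ≃ₐ[L] (MaximalSpectrum B → L) := ((IsArtinianRing.equivPi B).restrictScalars L).trans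
    (AlgEquiv.piCongrRight fun m => (AlgEquiv.ofBijective (Algebra.ofId L _) (hbij m)).symm)
  let := Fintype.ofFinite (MaximalSpectrum B)
  have hcard : Fintype.card (MaximalSpectrum B) = Fintype.card ι := by
    rw [← Module.finrank_eq_card_basis b, e.toLinearEquiv.finrank_eq,
      Module.finrank_fintype_fun_eq_card]
  exact ⟨e.trans (AlgEquiv.piCongrLeft L (fun _ => L) (Fintype.equivOfCardEq hcard))⟩

variable {r : ℕ} {β : BasisSet r} {A : Type*} [CommRing A]

/-- The discriminant of the algebra with basis `β` and structure constants `γ`. -/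
noncomputable def coeffDiscr (γ : (Fin r →₀ ℕ) → β.monos → A) : A :=
  (Matrix.of fun j j' : β.monos => ∑ l : β.monos, γ (j + j' + l) l).det

theorem map_coeffDiscr {A' : Type*} [CommRing A'] (φ : A →+* A')
    (γ : (Fin r →₀ ℕ) → β.monos → A) : φ (coeffDiscr γ) = coeffDiscr fun d j => φ (γ d j) := by
  rw [coeffDiscr, φ.map_det, coeffDiscr]
  congr 1
  ext j j'
  simp

theorem Expands.discr_eq {B : Type*} [CommRing B] [Algebra A B]
    {γ : (Fin r →₀ ℕ) → β.monos → A} {x : Fin r → B} (h : Expands γ x)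
    (b : Module.Basis β.monos A B) (hb : ∀ j, b j = monomialValue x (j : Fin r →₀ ℕ)) :
    Algebra.discr A b = coeffDiscr γ := by
  rw [Algebra.discr_def, coeffDiscr]
  congr 1
  ext j j'
  rw [Algebra.traceMatrix_apply, Algebra.traceForm_apply, Algebra.trace_eq_matrix_trace b,
    Matrix.trace, Matrix.of_apply]
  refine Finset.sum_congr rfl fun l _ => ?_
  rw [Matrix.diag_apply, Algebra.leftMulMatrix_eq_repr_mul, hb, hb, hb, ← monomialValue_add,
    ← monomialValue_add, h]
  simp only [← hb, b.repr_sum_self]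

theorem Expands.coeffDiscr_eq {γ : (Fin r →₀ ℕ) → β.monos → A} {x : Fin r → β.monos → A}
    (h : Expands γ x) (hx : IsUnit (valueDet x)) : coeffDiscr γ = valueDet x ^ 2 := by
  have hdet : (Pi.basisFun A β.monos).det
      (fun j : β.monos => monomialValue x (j : Fin r →₀ ℕ)) = valueDet x := by
    rw [Pi.basisFun_det_apply]
    rfl
  obtain ⟨hli, hspan⟩ := ((Pi.basisFun A β.monos).is_basis_iff_det).2 (hdet ▸ hx)
  rw [← h.discr_eq (.mk hli hspan.ge) (Module.Basis.mk_apply hli hspan.ge),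
    Module.Basis.coe_mk, discr_pi]
  rfl

/-- Over an algebraically closed field, a family with nonzero discriminant is the ideal of a set
of points. -/
theorem IsCoeffSystem.exists_points {L : Type u} [Field L] [IsAlgClosed L]
    {γ : (Fin r →₀ ℕ) → β.monos → L} (hγ : IsCoeffSystem γ) (hdiscr : coeffDiscr γ ≠ 0) :
    ∃ x : Fin r → β.monos → L, valueDet x ≠ 0 ∧ Expands γ x := by
  have hexp := expands_mk_X_iff.2 (le_refl (coeffIdeal γ))
  let b : Module.Basis β.monos L _ := .mk hγ.hasBasis.1 hγ.hasBasis.2.ge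
  have hb : ∀ j, b j = monomialValue (fun i => Ideal.Quotient.mk (coeffIdeal γ) (X i))
      (j : Fin r →₀ ℕ) := fun j => by rw [Module.Basis.mk_apply, monomialValue_mk_X]
  have := isReduced_of_discr_ne_zero b (by rwa [hexp.discr_eq b hb])
  obtain ⟨e⟩ := nonempty_algEquiv_pi_of_isReduced b
  refine ⟨_, ?_, hexp.map (e : _ →ₐ[L] β.monos → L)⟩
  have hli := b.linearIndependent.map' e.toLinearMap (LinearMap.ker_eq_bot.2 e.injective)
  have heb : (fun j : β.monos => monomialValue (fun i => e (Ideal.Quotient.mk _ (X i)))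
      (j : Fin r →₀ ℕ)) = e.toLinearMap ∘ b :=
    funext fun j => (map_monomialValue e _ _).symm.trans (congrArg e (hb j).symm)
  exact ((Matrix.isUnit_iff_isUnit_det _).1
    (Matrix.linearIndependent_rows_iff_isUnit.1 (heb ▸ hli))).ne_zero

end Discriminant

/-! ### Newton polynomials and grids -/

section Newton

variable {r : ℕ} {A : Type*} [CommRing A]

/-- The value at `x` of the multivariate Newton polynomial with nodes `α`, leading monomial `x^d`
and zeros at the grid points that are not above `d`. -/
noncomputable def newtonValue {B : Type*} [CommRing B] [Algebra A B] (α : ℕ → A) (x : Fin r → B)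
    (d : Fin r →₀ ℕ) : B :=
  ∏ i, ∏ s ∈ Finset.range (d i), (x i - algebraMap A B (α s))

section Algebra

variable {B : Type*} [CommRing B] [Algebra A B]

theorem newtonValue_zero_nodes (x : Fin r → B) (d : Fin r →₀ ℕ) :
    newtonValue (0 : ℕ → A) x d = monomialValue x d := by
  simp [newtonValue, monomialValue]

theorem newtonValue_add_single (α : ℕ → A) (x : Fin r → B) (d : Fin r →₀ ℕ) (i : Fin r) :
    newtonValue α x (d + Finsupp.single i 1) =
      (x i - algebraMap A B (α (d i))) * newtonValue α x d := by
  rw [newtonValue, newtonValue, ← Finset.mul_prod_erase _ _ (Finset.mem_univ i),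
    ← Finset.mul_prod_erase _ (fun i => ∏ s ∈ Finset.range (d i), _) (Finset.mem_univ i),
    ← mul_assoc]
  congr 1
  · simp [Finset.prod_range_succ, mul_comm]
  · refine Finset.prod_congr rfl fun k hk => ?_
    simp [Finsupp.single_eq_of_ne (Finset.ne_of_mem_erase hk)]

theorem aeval_newtonValue_X (α : ℕ → A) (x : Fin r → B) (d : Fin r →₀ ℕ) :
    aeval x (newtonValue α (X : Fin r → MvPolynomial (Fin r) A) d) = newtonValue α x d := by
  simp [newtonValue]

theorem newtonValue_mem_span (α α' : ℕ → A) (x : Fin r → B) (d : Fin r →₀ ℕ) :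
    newtonValue α x d ∈ Submodule.span A (newtonValue α' x '' Set.Iic d) := by
  induction d using exponent_induction with
  | zero => exact Submodule.subset_span ⟨0, Set.mem_Iic.2 le_rfl, by simp [newtonValue]⟩
  | add_single d i ih =>
    rw [newtonValue_add_single]
    suffices hle : Submodule.span A (newtonValue α' x '' Set.Iic d) ≤
        (Submodule.span A (newtonValue α' x '' Set.Iic (d + Finsupp.single i 1))).comap
          (LinearMap.mulLeft A (x i - algebraMap A B (α (d i)))) from hle ih
    refine Submodule.span_le.2 ?_
    rintro _ ⟨e, he, rfl⟩
    have hmul : (x i - algebraMap A B (α (d i))) * newtonValue α' x e =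
        newtonValue α' x (e + Finsupp.single i 1) +
          (α' (e i) - α (d i)) • newtonValue α' x e := by
      rw [newtonValue_add_single, Algebra.smul_def, map_sub]
      ring
    rw [SetLike.mem_coe, Submodule.mem_comap, LinearMap.mulLeft_apply, hmul]
    exact add_mem (Submodule.subset_span ⟨_, add_le_add_left (Set.mem_Iic.1 he) _, rfl⟩)
      (Submodule.smul_mem _ _ (Submodule.subset_span ⟨e, le_add_right (Set.mem_Iic.1 he), rfl⟩))

end Algebra

theorem map_newtonValue_X {B : Type*} [CommRing B] (φ : A →+* B) (α : ℕ → A)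
    (d : Fin r →₀ ℕ) :
    MvPolynomial.map φ (newtonValue α (X : Fin r → MvPolynomial (Fin r) A) d) =
      newtonValue (fun s => φ (α s)) X d := by
  simp [newtonValue]

variable {β : BasisSet r}

/-- The points of the grid with nodes `α` that are indexed by the exponents of `β`. -/
def gridPoint (β : BasisSet r) (α : ℕ → A) (i : Fin r) (p : β.monos) : A :=
  α ((p : Fin r →₀ ℕ) i)

theorem newtonValue_gridPoint_apply (α : ℕ → A) (d : Fin r →₀ ℕ) (p : β.monos) :
    newtonValue α (gridPoint β α) d p =
      ∏ i, ∏ s ∈ Finset.range (d i), (α ((p : Fin r →₀ ℕ) i) - α s) := by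
  simp [newtonValue, gridPoint]

theorem newtonValue_gridPoint_eq_zero (α : ℕ → A) {d : Fin r →₀ ℕ} {p : β.monos}
    (h : ¬ d ≤ p) : newtonValue α (gridPoint β α) d p = 0 := by
  obtain ⟨i, hi⟩ : ∃ i, (p : Fin r →₀ ℕ) i < d i := by
    by_contra! hcon
    exact h hcon
  rw [newtonValue_gridPoint_apply]
  exact Finset.prod_eq_zero (Finset.mem_univ i)
    (Finset.prod_eq_zero (Finset.mem_range.2 hi) (sub_self _))

theorem newtonValue_gridPoint_of_notMem (α : ℕ → A) {d : Fin r →₀ ℕ} (hd : d ∉ β.monos) :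
    newtonValue α (gridPoint β α) d = 0 :=
  funext fun p => newtonValue_gridPoint_eq_zero α fun h => hd (β.mem_of_le p.2 h)

theorem newtonValue_gridPoint_self_ne_zero [IsDomain A] {α : ℕ → A} (hα : Function.Injective α)
    (p : β.monos) : newtonValue α (gridPoint β α) p p ≠ 0 := by
  rw [newtonValue_gridPoint_apply]
  refine Finset.prod_ne_zero_iff.2 fun i _ => Finset.prod_ne_zero_iff.2 fun s hs => ?_
  exact sub_ne_zero.2 (hα.ne (Finset.mem_range.1 hs).ne')

theorem exists_expands_gridPoint (β : BasisSet r) (α : ℕ → A) :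
    ∃ γ : (Fin r →₀ ℕ) → β.monos → A, Expands γ (gridPoint β α) := by
  have hspan : ∀ d, monomialValue (gridPoint β α) d ∈
      Submodule.span A (Set.range fun j : β.monos => monomialValue (gridPoint β α) j) := by
    intro d
    rw [← newtonValue_zero_nodes (A := A)]
    refine Submodule.span_le.2 ?_ (newtonValue_mem_span 0 α _ d)
    rintro _ ⟨e, -, rfl⟩
    by_cases he : e ∈ β.monos
    · refine Submodule.span_mono ?_ (newtonValue_mem_span α 0 _ e)
      rintro _ ⟨j, hj, rfl⟩
      exact ⟨⟨j, β.mem_of_le he hj⟩, (newtonValue_zero_nodes _ j).symm⟩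
    · rw [newtonValue_gridPoint_of_notMem α he]
      exact zero_mem _
  choose γ hγ using fun d => (Submodule.mem_span_range_iff_exists_fun A).1 (hspan d)
  exact ⟨γ, fun d => (hγ d).symm⟩

/-- The values of the Newton polynomials form a triangular matrix. -/
theorem valueDet_gridPoint_ne_zero [IsDomain A] {α : ℕ → A} (hα : Function.Injective α) :
    valueDet (gridPoint β α) ≠ 0 := by
  intro h0
  obtain ⟨v, hv0, hv⟩ := Matrix.exists_mulVec_eq_zero_iff.2 h0
  have hN : ∀ e : β.monos, ∑ p, newtonValue α (gridPoint β α) e p * v p = 0 := by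
    intro e
    have hle : Submodule.span A (newtonValue (0 : ℕ → A) (gridPoint β α) '' Set.Iic ↑e) ≤
        LinearMap.ker (Fintype.linearCombination A v) := by
      refine Submodule.span_le.2 ?_
      rintro _ ⟨j, hj, rfl⟩
      rw [newtonValue_zero_nodes]
      exact congrFun hv ⟨j, β.mem_of_le e.2 (Set.mem_Iic.1 hj)⟩
    exact hle (newtonValue_mem_span α 0 _ _)
  obtain ⟨p, hp, hmax⟩ : ∃ p : β.monos, v p ≠ 0 ∧ ∀ q : β.monos, p < q → v q = 0 := by
    obtain ⟨p, hp⟩ := (Set.toFinite {p | v p ≠ 0}).exists_maximal (Function.ne_iff.1 hv0)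
    exact ⟨p, hp.1, fun q hpq => by_contra fun hq => hp.not_gt hq hpq⟩
  have hsum := hN p
  rw [Finset.sum_eq_single p (fun q _ hqp => ?_) (by simp)] at hsum
  · exact mul_ne_zero (newtonValue_gridPoint_self_ne_zero hα p) hp hsum
  · by_cases hle : p ≤ q
    · rw [hmax q (lt_of_le_of_ne hle hqp.symm), mul_zero]
    · rw [newtonValue_gridPoint_eq_zero α hle, zero_mul]

/-- If the nodes collapse to the origin, then the Newton polynomials vanishing on the grid become
monomials. -/
theorem Expands.map_eq_zero_of_gridPoint {A : Type u} {A' : Type*} [CommRing A] [IsDomain A]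
    [CommRing A'] {α : ℕ → A} (hα : Function.Injective α) {γ : (Fin r →₀ ℕ) → β.monos → A}
    (h : Expands γ (gridPoint β α)) (φ : A →+* A') (hφ : ∀ s, φ (α s) = 0) {d : Fin r →₀ ℕ}
    (hd : d ∉ β.monos) (j : β.monos) : φ (γ d j) = 0 := by
  have hli := linearIndependent_of_valueDet_ne_zero (valueDet_gridPoint_ne_zero (β := β) hα)
  have hsys := h.isCoeffSystem hli
  have hnewton : newtonValue α X d ∈ coeffIdeal γ := by
    rw [hsys.hasBasis.mem_iff le_rfl, ← h.aeval_eq_zero_iff hli, aeval_newtonValue_X,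
      newtonValue_gridPoint_of_notMem α hd]
  have hmap := Ideal.mem_map_of_mem (MvPolynomial.map φ) hnewton
  rw [coeffIdeal_map, map_newtonValue_X, funext hφ] at hmap
  have hmonomial : monomial d 1 ∈ coeffIdeal fun d j => φ (γ d j) := by
    rwa [← aeval_X_left_apply (monomial d (1 : A')), aeval_monomial_eq_smul, one_smul,
      ← newtonValue_zero_nodes (A := A')]
  have hcoords := (hsys.map φ).basisCoords_eq_zero_of_mem hmonomial
  rw [basisCoords_monomial, one_smul] at hcoords
  exact congrFun hcoords j

end Newton

/-! ### The principal component -/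

section PrincipalComponent

variable (K : Type u) [Field K] {r : ℕ} (β : BasisSet r)

/-- The nodes `t^{s+1}` over the polynomial ring `K[t]`, which collapse to the origin at
`t = 0`. -/
noncomputable def contractingNode (s : ℕ) : Polynomial K := Polynomial.X ^ (s + 1)

theorem contractingNode_injective : Function.Injective (contractingNode K) := fun s t h => by
  have hdeg := congrArg Polynomial.natDegree h
  rw [contractingNode, contractingNode, Polynomial.natDegree_X_pow,
    Polynomial.natDegree_X_pow] at hdeg
  exact Nat.succ_injective hdeg

/-- The determinant of the values of the monomials of `β` at points with indeterminate
coordinates. -/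
noncomputable def genericDet : MvPolynomial (Fin r × β.monos) K :=
  valueDet fun (i : Fin r) (p : β.monos) => X (i, p)

variable {K β} in
theorem aeval_genericDet {D : Type*} [CommRing D] [Algebra K D] (x : Fin r → β.monos → D) :
    aeval (fun ip : Fin r × β.monos => x ip.1 ip.2) (genericDet K β) = valueDet x := by
  have h := map_valueDet (aeval (R := K) fun ip : Fin r × β.monos => x ip.1 ip.2).toRingHom
    fun (i : Fin r) (p : β.monos) => X (i, p)
  simp only [AlgHom.toRingHom_eq_coe, RingHom.coe_coe, aeval_X] at h
  exact h

theorem genericDet_ne_zero : genericDet K β ≠ 0 := by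
  intro h
  refine valueDet_gridPoint_ne_zero (β := β) (contractingNode_injective K) ?_
  rw [← aeval_genericDet (K := K), h, map_zero]

/-- The coordinate ring of the space of points, indexed by `β`, that impose independent conditions
on the span of `β`. -/
abbrev GenericRing : Type u := Localization.Away (genericDet K β)

instance isDomain_genericRing : IsDomain (GenericRing K β) :=
  IsLocalization.isDomain_localization
    (powers_le_nonZeroDivisors_of_noZeroDivisors (genericDet_ne_zero K β))

/-- The universal family of such points. -/
noncomputable def indetPoint (i : Fin r) (p : β.monos) : GenericRing K β :=
  algebraMap (MvPolynomial (Fin r × β.monos) K) _ (X (i, p))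

theorem isUnit_valueDet_indetPoint : IsUnit (valueDet (indetPoint K β)) := by
  have h := map_valueDet (algebraMap (MvPolynomial (Fin r × β.monos) K) (GenericRing K β))
    fun (i : Fin r) (p : β.monos) => X (i, p)
  exact h ▸ IsLocalization.Away.algebraMap_isUnit (genericDet K β)

theorem exists_expands_indetPoint :
    ∃ φ : CoordRing K β →ₐ[K] GenericRing K β,
      Expands (fun d j => φ (universalCoeff K β d j)) (indetPoint K β) := by
  obtain ⟨γ, hγ⟩ := exists_expands_of_isUnit_valueDet (isUnit_valueDet_indetPoint K β)
  refine ⟨(hγ.isCoeffSystem (linearIndependent_of_valueDet_ne_zero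
    (isUnit_valueDet_indetPoint K β).ne_zero)).lift, ?_⟩
  simpa only [IsCoeffSystem.lift_universalCoeff] using hγ

/-- The morphism to `U_β` sending a family of points to the ideal of polynomials vanishing
there. -/
noncomputable def genericMap : CoordRing K β →ₐ[K] GenericRing K β :=
  (exists_expands_indetPoint K β).choose

theorem expands_genericMap :
    Expands (fun d j => genericMap K β (universalCoeff K β d j)) (indetPoint K β) :=
  (exists_expands_indetPoint K β).choose_spec

/-- The ideal of the closure of the locus in `U_β` of reduced families of points. -/
noncomputable def principalComponent : Ideal (CoordRing K β) := RingHom.ker (genericMap K β)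

instance isPrime_principalComponent : (principalComponent K β).IsPrime :=
  RingHom.ker_isPrime (genericMap K β)

variable {K β}

theorem exists_comp_genericMap_eq {F : Type*} [Field F] [Algebra K F]
    (φ : CoordRing K β →ₐ[K] F) {x : Fin r → β.monos → F} (hx : valueDet x ≠ 0)
    (h : Expands (fun d j => φ (universalCoeff K β d j)) x) :
    ∃ σ : GenericRing K β →ₐ[K] F, σ.comp (genericMap K β) = φ := by
  let ev : MvPolynomial (Fin r × β.monos) K →ₐ[K] F := aeval fun ip => x ip.1 ip.2
  have hunit : ∀ s : Submonoid.powers (genericDet K β), IsUnit (ev s) := by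
    rintro ⟨_, n, rfl⟩
    rw [map_pow, aeval_genericDet]
    exact hx.isUnit.pow n
  let σ : GenericRing K β →ₐ[K] F := IsLocalization.liftAlgHom hunit
  have hσ : (fun i p => (σ : GenericRing K β →+* F) (indetPoint K β i p)) = x := by
    funext i p
    change σ (algebraMap _ _ (X (i, p))) = _
    rw [IsLocalization.liftAlgHom_apply, IsLocalization.lift_eq]
    exact aeval_X _ _
  have hexp := (expands_genericMap K β).map_pi (σ : GenericRing K β →+* F)
  rw [hσ] at hexp
  exact ⟨σ, CoordRing.algHom_ext <| congrFun₂ <|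
    hexp.unique h (linearIndependent_of_valueDet_ne_zero hx)⟩

theorem principalComponent_le_ker {D : Type*} [CommRing D] [IsDomain D] [Algebra K D]
    (ψ : CoordRing K β →ₐ[K] D) {x : Fin r → β.monos → D} (hx : valueDet x ≠ 0)
    (h : Expands (fun d j => ψ (universalCoeff K β d j)) x) :
    principalComponent K β ≤ RingHom.ker ψ := by
  let F := FractionRing D
  have hinj := IsFractionRing.injective D F
  obtain ⟨σ, hσ⟩ := exists_comp_genericMap_eq ((IsScalarTower.toAlgHom K D F).comp ψ)
    (by rw [← map_valueDet]; exact (map_ne_zero_iff _ hinj).2 hx) (h.map_pi (algebraMap D F))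
  intro f hf
  have hψ : algebraMap D F (ψ f) = σ (genericMap K β f) := (DFunLike.congr_fun hσ f).symm
  rw [(hf : genericMap K β f = 0), map_zero] at hψ
  exact (map_eq_zero_iff _ hinj).1 hψ

theorem principalComponent_le_originIdeal : principalComponent K β ≤ originIdeal K β := by
  have hα := contractingNode_injective K
  obtain ⟨γ, hγ⟩ := exists_expands_gridPoint β (contractingNode K)
  have hsys := hγ.isCoeffSystem
    (linearIndependent_of_valueDet_ne_zero (valueDet_gridPoint_ne_zero hα))
  let ev : Polynomial K →ₐ[K] K := Polynomial.aeval 0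
  have hev : ∀ d ∉ β.monos, ∀ j, ev (γ d j) = 0 := fun d hd j =>
    hγ.map_eq_zero_of_gridPoint hα (ev : Polynomial K →+* K)
      (fun s => by simp [ev, contractingNode]) hd j
  have horigin : ev.comp hsys.lift = originPoint K β := CoordRing.algHom_ext fun d j => by
    by_cases hd : d ∈ β.monos
    · rw [(isCoeffSystem_universalCoeff K β).apply_coe ⟨d, hd⟩]
      simp [Pi.single_apply, apply_ite]
    · rw [originPoint_universalCoeff hd, AlgHom.comp_apply, hsys.lift_universalCoeff, hev d hd]
  have hexp : Expands (fun d j => hsys.lift (K := K) (universalCoeff K β d j))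
      (gridPoint β (contractingNode K)) := by
    simpa only [IsCoeffSystem.lift_universalCoeff] using hγ
  intro f hf
  change originPoint K β f = 0
  rw [← horigin, AlgHom.comp_apply,
    principalComponent_le_ker hsys.lift (valueDet_gridPoint_ne_zero hα) hexp hf, map_zero]

theorem coeffDiscr_notMem_principalComponent :
    coeffDiscr (universalCoeff K β) ∉ principalComponent K β := by
  intro h
  have hdiscr : (genericMap K β : CoordRing K β →+* GenericRing K β)
      (coeffDiscr (universalCoeff K β)) = 0 := h
  rw [map_coeffDiscr] at hdiscr
  exact ((isUnit_valueDet_indetPoint K β).pow 2).ne_zero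
    (((expands_genericMap K β).coeffDiscr_eq (isUnit_valueDet_indetPoint K β)).symm.trans hdiscr)

theorem eq_principalComponent_of_le {Q : Ideal (CoordRing K β)} [Q.IsPrime]
    (hQ : Q ≤ principalComponent K β) : Q = principalComponent K β := by
  refine le_antisymm hQ ?_
  let D := CoordRing K β ⧸ Q
  let L := AlgebraicClosure (FractionRing D)
  let ψ : CoordRing K β →ₐ[K] L :=
    ((IsScalarTower.toAlgHom K (FractionRing D) L).comp
      (IsScalarTower.toAlgHom K D (FractionRing D))).comp (Ideal.Quotient.mkₐ K Q)
  have hker : RingHom.ker ψ ≤ Q := fun f (hf : algebraMap (FractionRing D) L _ = 0) => by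
    rw [map_eq_zero_iff _ (algebraMap (FractionRing D) L).injective] at hf
    exact Ideal.Quotient.eq_zero_iff_mem.1
      ((map_eq_zero_iff _ (IsFractionRing.injective D (FractionRing D))).1 hf)
  have hsys := (isCoeffSystem_universalCoeff K β).map (ψ : CoordRing K β →+* L)
  obtain ⟨x, hx, hexp⟩ := hsys.exists_points <| by
    rw [← map_coeffDiscr]
    exact fun h0 => coeffDiscr_notMem_principalComponent (hQ (hker h0))
  exact (principalComponent_le_ker ψ hx hexp).trans hker

end PrincipalComponent

/-! ### The dimension of the principal component -/

section Dimension

/-- The coordinates act by multiplication on the span of the monomials of `β`. -/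
theorem Expands.isIntegral {r : ℕ} {β : BasisSet r} {A B : Type*} [CommRing A] [CommRing B]
    [Algebra A B] {γ : (Fin r →₀ ℕ) → β.monos → A} {x : Fin r → B} (h : Expands γ x) (i : Fin r) :
    IsIntegral A (x i) := by
  have hle : Subalgebra.toSubmodule (aeval (R := A) x).range ≤
      Submodule.span A (Set.range fun j : β.monos => monomialValue x (j : Fin r →₀ ℕ)) := by
    rintro _ ⟨f, rfl⟩
    exact (Submodule.mem_span_range_iff_exists_fun A).2 ⟨_, (h.aeval_eq f).symm⟩
  have hge : Submodule.span A (Set.range fun j : β.monos => monomialValue x (j : Fin r →₀ ℕ)) ≤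
      Subalgebra.toSubmodule (aeval (R := A) x).range := by
    refine Submodule.span_le.2 ?_
    rintro _ ⟨j, rfl⟩
    exact ⟨monomial j 1, (aeval_monomial_eq_smul x _ _).trans (one_smul A _)⟩
  refine IsIntegral.of_mem_of_fg (aeval (R := A) x).range ?_ _ ⟨X i, aeval_X x i⟩
  rw [le_antisymm hle hge]
  exact Submodule.fg_span (Set.finite_range _)

theorem expands_algebraMap_iff {r : ℕ} {β : BasisSet r} {A A' B : Type*} [CommRing A] [CommRing A']
    [CommRing B] [Algebra A A'] [Algebra A B] [Algebra A' B] [IsScalarTower A A' B]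
    {γ : (Fin r →₀ ℕ) → β.monos → A} {x : Fin r → B} :
    Expands (fun d j => algebraMap A A' (γ d j)) x ↔ Expands γ x := by
  simp only [Expands, algebraMap_smul]

theorem isAlgebraic_of_isLocalization_mvPolynomial {σ K D E : Type*} [CommRing K] [CommRing D]
    [IsDomain D] [CommRing E] [Algebra K D] [Algebra K E] [Algebra D E] [IsScalarTower K D E]
    [Algebra (MvPolynomial σ K) E] [IsScalarTower K (MvPolynomial σ K) E]
    (S : Submonoid (MvPolynomial σ K)) [IsLocalization S E]
    (hX : ∀ s, IsAlgebraic D (algebraMap (MvPolynomial σ K) E (X s))) :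
    Algebra.IsAlgebraic D E := by
  have hpoly (f : MvPolynomial σ K) : IsAlgebraic D (algebraMap (MvPolynomial σ K) E f) := by
    have hle : Algebra.adjoin K (Set.range X) ≤
        ((Subalgebra.algebraicClosure D E).restrictScalars K).comap
          (IsScalarTower.toAlgHom K (MvPolynomial σ K) E) := by
      rw [Algebra.adjoin_le_iff]
      rintro _ ⟨s, rfl⟩
      exact hX s
    rw [adjoin_range_X] at hle
    exact hle (Algebra.mem_top (x := f))
  refine ⟨fun x => ?_⟩
  obtain ⟨⟨f, u⟩, hx⟩ := IsLocalization.surj S x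
  refine IsAlgebraic.of_mul (IsLocalization.map_units E u).mem_nonZeroDivisors (hpoly u) ?_
  rw [mul_comm, hx]
  exact hpoly f

variable (K : Type u) [Field K] {r : ℕ} (β : BasisSet r)

theorem trdeg_genericRing : Algebra.trdeg K (GenericRing K β) = (r * β.monos.card : ℕ) := by
  have : Algebra.IsAlgebraic (MvPolynomial (Fin r × β.monos) K) (GenericRing K β) :=
    IsLocalization.isAlgebraic _ (Submonoid.powers (genericDet K β))
  have : FaithfulSMul (MvPolynomial (Fin r × β.monos) K) (GenericRing K β) :=
    (faithfulSMul_iff_algebraMap_injective _ _).2 (IsLocalization.injective _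
      (powers_le_nonZeroDivisors_of_noZeroDivisors (genericDet_ne_zero K β)))
  rw [← trdeg_add_eq K (MvPolynomial (Fin r × β.monos) K) (A := GenericRing K β),
    trdeg_eq_zero (R := MvPolynomial (Fin r × β.monos) K)]
  simp

variable {K β} in
theorem trdeg_eq_of_injective_genericRing {D : Type u} [CommRing D] [IsDomain D] [Algebra K D]
    {γ : (Fin r →₀ ℕ) → β.monos → D} (φ : D →ₐ[K] GenericRing K β) (hφ : Function.Injective φ)
    (hγ : Expands (fun d j => φ (γ d j)) (indetPoint K β)) :
    Algebra.trdeg K D = (r * β.monos.card : ℕ) := by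
  let : Algebra D (GenericRing K β) := φ.toRingHom.toAlgebra
  have : IsScalarTower K D (GenericRing K β) :=
    IsScalarTower.of_algebraMap_eq fun x => (φ.commutes x).symm
  have : FaithfulSMul D (GenericRing K β) :=
    (faithfulSMul_iff_algebraMap_injective _ _).2 hφ
  have hexp : Expands γ (indetPoint K β) := expands_algebraMap_iff.1 hγ
  have : Algebra.IsAlgebraic D (GenericRing K β) := isAlgebraic_of_isLocalization_mvPolynomial
    (K := K) (Submonoid.powers (genericDet K β)) fun ⟨i, p⟩ =>
      ((hexp.isIntegral i).map (Pi.evalAlgHom D (fun _ : β.monos => GenericRing K β) p)).isAlgebraic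
  rw [← trdeg_genericRing K β, ← trdeg_add_eq K D (A := GenericRing K β),
    trdeg_eq_zero (R := D), add_zero]

theorem trdeg_quotient_principalComponent :
    Algebra.trdeg K (CoordRing K β ⧸ principalComponent K β) = (r * β.monos.card : ℕ) :=
  trdeg_eq_of_injective_genericRing (Ideal.kerLiftAlg (genericMap K β))
    (γ := fun d j => Ideal.Quotient.mk _ (universalCoeff K β d j))
    (Ideal.kerLiftAlg_injective _) (expands_genericMap K β)

theorem originPoint_surjective : Function.Surjective (originPoint K β) := fun c =>
  ⟨algebraMap K _ c, AlgHom.commutes _ c⟩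

instance originIdeal_isMaximal : (originIdeal K β).IsMaximal :=
  RingHom.ker_isMaximal_of_surjective _ (originPoint_surjective K β)

theorem height_map_originIdeal :
    ((originIdeal K β).map (Ideal.Quotient.mk (principalComponent K β))).height =
      (r * β.monos.card : ℕ) := by
  have : ((originIdeal K β).map (Ideal.Quotient.mk (principalComponent K β))).IsMaximal :=
    Ideal.IsMaximal.map_of_surjective_of_ker_le Ideal.Quotient.mk_surjective
      (Ideal.mk_ker.trans_le principalComponent_le_originIdeal)
  exact height_eq_of_isMaximal_of_trdeg_eq (trdeg_quotient_principalComponent K β) _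

theorem le_height_originIdeal :
    ((r * β.monos.card : ℕ) : ℕ∞) ≤ (originIdeal K β).height := by
  rw [← height_map_originIdeal K β]
  exact height_map_mk_le_height principalComponent_le_originIdeal

/-- If the local ring is a domain, then the principal component is the only component through the
point. -/
theorem height_originIdeal_le [IsDomain (Localization.AtPrime (originIdeal K β))] :
    (originIdeal K β).height ≤ ((r * β.monos.card : ℕ) : ℕ∞) := by
  let L := Localization.AtPrime (originIdeal K β)
  let Q : Ideal (CoordRing K β) := RingHom.ker (algebraMap (CoordRing K β) L)
  have : Q.IsPrime := RingHom.ker_isPrime _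
  have hQ : ∀ p : Ideal (CoordRing K β), p.IsPrime → p ≤ originIdeal K β → Q ≤ p := by
    intro p hp hpM f hf
    obtain ⟨u, hu⟩ := (IsLocalization.map_eq_zero_iff (originIdeal K β).primeCompl L f).1 hf
    have hmem : (u : CoordRing K β) * f ∈ p := hu ▸ p.zero_mem
    exact (hp.mem_or_mem hmem).resolve_left fun h => u.2 (hpM h)
  have hQP : Q = principalComponent K β := eq_principalComponent_of_le
    (hQ _ inferInstance principalComponent_le_originIdeal)
  rw [← height_map_originIdeal K β, ← hQP]
  exact height_le_height_map_mk hQ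

end Dimension

section Nonsingular

variable {K : Type u} [Field K] {r : ℕ} {β : BasisSet r}

instance isNoetherianRing_coordRing : IsNoetherianRing (CoordRing K β) :=
  Algebra.FiniteType.isNoetherianRing K _

instance finite_cotangent_originIdeal : Module.Finite K (originIdeal K β).Cotangent :=
  finite_cotangent (algebraMap_quotient_ker_surjective (originPoint K β))

variable (K β) in
theorem isNonsingularPoint_iff_finrank_le :
    IsNonsingularPoint K β ↔
      Module.finrank K (originIdeal K β).Cotangent ≤ r * β.monos.card := by
  have hiff := isRegularLocalRing_localization_iff (M := originIdeal K β)
    (algebraMap_quotient_ker_surjective (originPoint K β))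
  refine ⟨fun h => ?_, fun h => hiff.2 <| (Nat.cast_le.2 h).trans (le_height_originIdeal K β)⟩
  have : IsRegularLocalRing (Localization.AtPrime (originIdeal K β)) := h
  have := isDomain_of_isRegularLocalRing (Localization.AtPrime (originIdeal K β))
  exact Nat.cast_le.1 ((hiff.1 h).trans (height_originIdeal_le K β))

namespace BasisSet.IsStandardBunch

variable {S : Set (Arrow β)}

theorem isNonsingularPoint_iff (h : β.IsStandardBunch S) :
    IsNonsingularPoint K β ↔ Submodule.span K (arrowClass K '' S) = ⊤ := by
  have hli := h.linearIndependent (K := K)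
  have := h.finite.fintype
  have hcard : Fintype.card S = r * β.monos.card := by
    rw [← Nat.card_eq_fintype_card, Nat.card_coe_set_eq, h.ncard_eq]
  rw [isNonsingularPoint_iff_finrank_le, Set.image_eq_range]
  constructor
  · intro hle
    exact hli.span_eq_top_of_card_eq_finrank'
      (hli.fintype_card_le_finrank.antisymm (hcard ▸ hle))
  · intro hspan
    rw [Module.finrank_eq_card_basis (.mk hli hspan.ge), hcard]

theorem le_rank_cotangent (h : β.IsStandardBunch S) :
    ((r * β.monos.card : ℕ) : Cardinal) ≤ Module.rank K (originIdeal K β).Cotangent := by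
  have := h.finite.fintype
  have hle := (h.linearIndependent (K := K)).fintype_card_le_finrank
  rwa [← Nat.card_eq_fintype_card, Nat.card_coe_set_eq, h.ncard_eq, ← Nat.cast_le (α := Cardinal),
    Module.finrank_eq_rank] at hle

end BasisSet.IsStandardBunch

end Nonsingular

theorem mainTheorem1_general {K : Type u} [Field K] {r : ℕ} (β : BasisSet r) :
    IsUniversalFamily K β (CoordRing K β) (universalIdeal K β) ∧
    (universalIdeal K β).map (MvPolynomial.map (originPoint K β : CoordRing K β →+* K)) =
      monomialIdeal K β ∧
    (∃ S : Set (Arrow β), β.IsStandardBunch S) ∧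
    (∀ S : Set (Arrow β), β.IsStandardBunch S →
      (∀ a ∈ S, a.IsMinimal ∧ a.IsStandard) ∧
      S.Finite ∧ S.ncard = r * β.monos.card ∧
      LinearIndependent K (fun a : S => arrowClass K (a : Arrow β)) ∧
      (IsNonsingularPoint K β ↔ Submodule.span K (arrowClass K '' S) = ⊤)) ∧
    ((r * β.monos.card : ℕ) : Cardinal) ≤ Module.rank K (originIdeal K β).Cotangent := by
  obtain ⟨S₀, hS₀⟩ := β.exists_isStandardBunch
  exact ⟨isUniversalFamily_universalIdeal K β, universalIdeal_map_originPoint K β, ⟨S₀, hS₀⟩,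
    fun S hS => ⟨fun a ha => hS.isMinimal_and_isStandard ha, hS.finite, hS.ncard_eq,
      hS.linearIndependent, hS.isNonsingularPoint_iff⟩,
    hS₀.le_rank_cotangent⟩

theorem mainTheorem1 {K : Type u} [Field K] [IsAlgClosed K] {r : ℕ} (β : BasisSet r) :
    -- `R` is the coordinate ring of `U_β`, and `t_β` is the point corresponding to `I_β`
    IsUniversalFamily K β (CoordRing K β) (universalIdeal K β) ∧
    (universalIdeal K β).map (MvPolynomial.map (originPoint K β : CoordRing K β →+* K)) =
      monomialIdeal K β ∧
    -- iterated shadow promotion produces a set of arrows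
    (∃ S : Set (Arrow β), β.IsStandardBunch S) ∧
    -- every set so produced has the asserted properties
    (∀ S : Set (Arrow β), β.IsStandardBunch S →
      (∀ a ∈ S, a.IsMinimal ∧ a.IsStandard) ∧
      S.Finite ∧ S.ncard = r * β.monos.card ∧
      LinearIndependent K (fun a : S => arrowClass K (a : Arrow β)) ∧
      (IsNonsingularPoint K β ↔ Submodule.span K (arrowClass K '' S) = ⊤)) ∧
    ((r * β.monos.card : ℕ) : Cardinal) ≤ Module.rank K (originIdeal K β).Cotangent :=
  mainTheorem1_general β
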